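/- \textbf{Theorem (Free entropy concentration).} Let $P_A$ be a probability measure on $\mathbb{R}^k$, let $\Delta>0$, and let $f:\mathbb{R}\times\mathbb{R}^k\to\mathbb{R}$ and $\varphi:\mathbb{R}\to\mathbb{R}$ satisfy: (A1) $\varphi\in C^3$ is Lipschitz and odd, and has bounded second and third derivatives; (A2) $f$ is measurable, and for $P_A$-almost every $A$ the function $f(\cdot\,;A)$ is twice differentiable, and it and its first and second derivatives are bounded by a constant that does not depend on $A$. Put $\rho:=\mathbb{E}\,\varphi'(N)$ and $\epsilon:=\mathbb{E}\,\varphi(N)^2-\rho^2$ with $N\sim\mathcal{N}(0,1)$, and $$P_{\rm out}(y\mid x):=\int P_A(dA)\,\frac{1}{\sqrt{2\pi\Delta}}\,e^{-\frac{1}{2\Delta}(y-f(x;A))^2}.$$ For $d,p,n\ge 1$ and $t\in[0,1]$ let $\mathbf a^*\in\mathbb{R}^p$, $\mathbf W^*\in\mathbb{R}^{p\times d}$, $\mathbf v^*\in\mathbb{R}^d$, and for $\mu=1,\dots,n$ let $\xi^*_\mu\in\mathbb{R}$, $\mathbf X_\mu\in\mathbb{R}^d$, $Z_\mu\in\mathbb{R}$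 have i.i.d. $\mathcal{N}(0,1)$ entries and let $A_\mu\sim P_A$, all independent. Set $$S_{t\mu}:=\sqrt{1-t}\,\frac{\mathbf a^{*\intercal}}{\sqrt p}\,\varphi\Big(\frac{\mathbf W^*\mathbf X_\mu}{\sqrt d}\Big)+\sqrt t\,\rho\,\frac{\mathbf v^{*\intercal}\mathbf X_\mu}{\sqrt d}+\sqrt{t\epsilon}\,\xi^*_\mu,\qquad Y_{t\mu}:=f(S_{t\mu};A_\mu)+\sqrt\Delta\,Z_\mu ,$$ where $\varphi$ acts componentwise, let $s_{t\mu}$ be given by the formula for $S_{t\mu}$ with $(\mathbf a^*,\mathbf W^*,\mathbf v^*,\xi^*_\mu)$ replaced by $(\mathbf a,\mathbf W,\mathbf v,\xi_\mu)$, and let $$\mathcal{Z}_t:=\int D\mathbf a\,D\mathbf W\,D\mathbf v\,D\boldsymbol\xi\;\exp\Big(\sum_{\mu=1}^n\log P_{\rm out}(Y_{t\mu}\mid s_{t\mu})\Big),$$ where $D$ denotes integration against i.i.d. standard Gaussian entries. Write $\mathbb{E}_{\setminus\mathbf a^*}$ and $\mathbb{V}_{\setminus\mathbf a^*}$ for expectation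 and variance with respect to $(\mathbf W^*,\mathbf v^*,\boldsymbol\xi^*,\mathbf X,\mathbf A,\mathbf Z)$ at fixed $\mathbf a^*$. Then there is a constant $C\ge 0$, depending only on $\varphi$ and on the channel $(f,P_A,\Delta)$, such that for all $d,p,n\ge1$ and all $t\in[0,1]$ the random variable $\frac1n\log\mathcal{Z}_t$ is square integrable and $$\mathbb{E}_{\mathbf a^*}\mathbb{V}_{\setminus\mathbf a^*}\Big(\frac1n\log\mathcal{Z}_t\Big)=\mathbb{E}\Big(\frac1n\log\mathcal{Z}_t-\mathbb{E}_{\setminus\mathbf a^*}\frac1n\log\mathcal{Z}_t\Big)^2\le C\Big(\frac1d+\frac1n\Big).$$ -/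

import Mathlib

open MeasureTheory ProbabilityTheory
open scoped NNReal

noncomputable section

namespace TwoLayer

/-- Regularity of the activation function. -/
structure ActivationRegular (φ : ℝ → ℝ) : Prop where
  contDiff : ContDiff ℝ 3 φ
  lipschitz : ∃ c : ℝ≥0, LipschitzWith c φ
  odd : Function.Odd φ
  bdd_second : ∃ K : ℝ, ∀ x, |iteratedDeriv 2 φ x| ≤ K
  bdd_third : ∃ K : ℝ, ∀ x, |iteratedDeriv 3 φ x| ≤ K

/-- Regularity of the readout `f (x ; A)`: for `PA`-almost every `A` the function `f (· ; A)` is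
twice differentiable, and it and its first two derivatives in `x` are bounded, by a constant that
does not depend on `A`. -/
structure ReadoutRegular {k : ℕ} (PA : Measure (Fin k → ℝ)) (f : ℝ → (Fin k → ℝ) → ℝ) :
    Prop where
  measurable : Measurable (Function.uncurry f)
  differentiable : ∀ᵐ A ∂PA, Differentiable ℝ (fun x => f x A) ∧
    Differentiable ℝ (deriv (fun x => f x A))
  bdd : ∃ K : ℝ, ∀ᵐ A ∂PA, ∀ x, |f x A| ≤ K ∧ |deriv (fun x => f x A) x| ≤ K ∧
    |deriv (deriv (fun x => f x A)) x| ≤ K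

/-- `ρ = E φ'(N)` for a standard Gaussian variable `N`. -/
def rho (φ : ℝ → ℝ) : ℝ := ∫ x, deriv φ x ∂(gaussianReal 0 1)

/-- `ε = E φ(N)² - ρ²` for a standard Gaussian variable `N`. -/
def eps (φ : ℝ → ℝ) : ℝ := (∫ x, φ x ^ 2 ∂(gaussianReal 0 1)) - rho φ ^ 2

/-- The law of a vector with i.i.d. standard Gaussian entries. -/
def gaussVec (m : ℕ) : Measure (Fin m → ℝ) := Measure.pi fun _ => gaussianReal 0 1

/-- The law of an `m × l` array with i.i.d. standard Gaussian entries. -/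
def gaussMat (m l : ℕ) : Measure (Fin m → Fin l → ℝ) := Measure.pi fun _ => gaussVec l

/-- The output kernel `P_out (y | x)`. -/
def Pout {k : ℕ} (PA : Measure (Fin k → ℝ)) (f : ℝ → (Fin k → ℝ) → ℝ) (Δ y x : ℝ) : ℝ :=
  ∫ A, 1 / √(2 * Real.pi * Δ) * Real.exp (-(1 / (2 * Δ)) * (y - f x A) ^ 2) ∂PA

/-- `u_y (x) = log P_out (y | x)`. -/
def logPout {k : ℕ} (PA : Measure (Fin k → ℝ)) (f : ℝ → (Fin k → ℝ) → ℝ) (Δ y x : ℝ) : ℝ :=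
  Real.log (Pout PA f Δ y x)

/-- The interpolating argument of the channel at one input `x`, for the weights `a, W, v` and the
effective noise `ξ`: evaluated at the teacher's weights this is `S_{tμ}`, at the student's weights
it is `s_{tμ}`. -/
def interpField {d p : ℕ} (φ : ℝ → ℝ) (t : ℝ) (a : Fin p → ℝ) (W : Fin p → Fin d → ℝ)
    (v : Fin d → ℝ) (ξ : ℝ) (x : Fin d → ℝ) : ℝ :=
  √(1 - t) * ((∑ i, a i * φ ((∑ j, W i j * x j) / √d)) / √p)
    + √t * rho φ * ((∑ j, v j * x j) / √d)
    + √(t * eps φ) * ξ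

/-- The parameters `(a, W, v, ξ)` of the interpolating student. -/
abbrev Params (d p n : ℕ) : Type :=
  (Fin p → ℝ) × (Fin p → Fin d → ℝ) × (Fin d → ℝ) × (Fin n → ℝ)

/-- The prior `Da DW Dv Dξ`. -/
def prior (d p n : ℕ) : Measure (Params d p n) :=
  (gaussVec p).prod ((gaussMat p d).prod ((gaussVec d).prod (gaussVec n)))

/-- The partition function `Z_t` of the data set with inputs `X` and responses `Y`. -/
def partitionFn {d n k : ℕ} (p : ℕ) (PA : Measure (Fin k → ℝ)) (f : ℝ → (Fin k → ℝ) → ℝ)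
    (Δ : ℝ) (φ : ℝ → ℝ) (t : ℝ) (X : Fin n → Fin d → ℝ) (Y : Fin n → ℝ) : ℝ :=
  ∫ θ : Params d p n, Real.exp (∑ μ : Fin n,
    logPout PA f Δ (Y μ) (interpField φ t θ.1 θ.2.1 θ.2.2.1 (θ.2.2.2 μ) (X μ))) ∂(prior d p n)

/-- All the quenched disorder except the teacher's readout weights `a*`: the tuple
`(W*, v*, ξ*, X, A, Z)` of the teacher's inner weights, the linear teacher's weights, its effective
noise, the inputs, the randomness of the readout and the label noise. -/
abbrev Disorder (d p n k : ℕ) : Type :=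
  (Fin p → Fin d → ℝ) × (Fin d → ℝ) × (Fin n → ℝ) × (Fin n → Fin d → ℝ) ×
    (Fin n → Fin k → ℝ) × (Fin n → ℝ)

/-- The law of the disorder: all components are independent, the `A_μ` have law `PA`, and all other
entries are standard Gaussian. -/
def disorderLaw {k : ℕ} (d p n : ℕ) (PA : Measure (Fin k → ℝ)) : Measure (Disorder d p n k) :=
  (gaussMat p d).prod ((gaussVec d).prod ((gaussVec n).prod ((gaussMat n d).prod
    ((Measure.pi fun _ : Fin n => PA).prod (gaussVec n)))))

/-- The responses `Y_{tμ} = f (S_{tμ} ; A_μ) + √Δ Z_μ` of the interpolating teacher. -/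
def response {d p n k : ℕ} (f : ℝ → (Fin k → ℝ) → ℝ) (Δ : ℝ) (φ : ℝ → ℝ) (t : ℝ)
    (a : Fin p → ℝ) : Disorder d p n k → Fin n → ℝ :=
  fun (W, v, ξ, X, A, Z) μ => f (interpField φ t a W v (ξ μ) (X μ)) (A μ) + √Δ * Z μ

/-- The free entropy per sample `(1/n) log Z_t`, as a function of `a*` and of the rest of the
disorder. -/
def freeEntropy {d p n k : ℕ} (PA : Measure (Fin k → ℝ)) (f : ℝ → (Fin k → ℝ) → ℝ)
    (Δ : ℝ) (φ : ℝ → ℝ) (t : ℝ) (a : Fin p → ℝ) (ω : Disorder d p n k) : ℝ :=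
  1 / (n : ℝ) * Real.log (partitionFn p PA f Δ φ t ω.2.2.2.1 (response f Δ φ t a ω))

end TwoLayer

end

noncomputable section

namespace TwoLayer

/-! ### Variance on product spaces, and Bessel's inequality -/

section VarianceTools

variable {α β : Type*} [MeasurableSpace α] [MeasurableSpace β]

/-! Fix `a*` and split the rest of the disorder into the inner weights `w = (W*, v*)` and the `n`
i.i.d. samples `(ξ_μ, X_μ, A_μ, Z_μ)`. By the law of total variance, the variance of `log Z_t` is
the mean over `w` of its variance over the samples, plus the variance over `w` of its mean over the
samples.

Samples. As `f` is bounded by some `K`, the response is the label noise up to `K`, so `|log P_out|`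
is at most a quadratic function of `|Z_μ|`, whatever the fields are. Replacing one sample changes
one summand of the log-likelihood, and a logarithm of an integral of exponentials is 1-Lipschitz in
the exponent. An Efron–Stein bound (`memLp_and_variance_pi_le`) then gives a variance of order `n`.

Weights. The Gaussian Poincaré inequality (`variance_le_of_hasDerivAt_rotation`) is applied to `w ↦
E log Z_t`, the mean being over the samples. The teacher's weights enter `Z_t` only through the
responses, so a derivative in `w` is a sum over `μ` of a sensitivity `s_μ`, bounded by an affine
function of `|Z_μ|`, times the derivative of the teacher's field. The gradient has coordinates
`√(1-t) a_i / √(pd) · Σ_μ E[s_μ φ'(·) X_μj]` and `√t ρ / √d · Σ_μ E[s_μ X_μj]`. Since the `X_μj`, `j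
≤ d`, are orthonormal in `L²`, Bessel's inequality bounds the sum over `j` of the squared
expectations with no factor `d`, so the prefactor `1/d` survives. The squared gradient is of order
`n²/d · (L² |a*|²/p + ρ²)`, where `L` is a Lipschitz constant of `φ`; this is
`integral_dMeanLogPartition_sq_le`.

Division by `n²` leaves `1/n` and `1/d`, and `E |a*|² = p` removes the dependence on `p`. The
argument is run for a readout that is regular for every `A`; a modification on a null set of `A`
reduces the theorem to that case. -/

theorem sq_integral_le_integral_sq {P : Measure α} [IsProbabilityMeasure P] {g : α → ℝ}
    (hg : MemLp g 2 P) : (∫ x, g x ∂P) ^ 2 ≤ ∫ x, g x ^ 2 ∂P := by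
  have h := variance_nonneg g P
  rw [variance_eq_sub hg] at h
  simpa using h

/-- The variance is half the mean square difference of two independent copies. -/
theorem two_mul_variance_eq {P : Measure α} [IsProbabilityMeasure P] {g : α → ℝ}
    (hg : MemLp g 2 P) :
    2 * Var[g; P] = ∫ z : α × α, (g z.1 - g z.2) ^ 2 ∂(P.prod P) := by
  have h1 : Integrable (fun z : α × α => g z.1 ^ 2) (P.prod P) := hg.integrable_sq.comp_fst P
  have h2 : Integrable (fun z : α × α => g z.2 ^ 2) (P.prod P) := hg.integrable_sq.comp_snd P
  have hi : Integrable g P := hg.integrable (by norm_num)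
  have h3 : Integrable (fun z : α × α => g z.1 * g z.2) (P.prod P) := hi.mul_prod hi
  have e : (fun z : α × α => (g z.1 - g z.2) ^ 2)
      = fun z => (g z.1 ^ 2 + g z.2 ^ 2) - 2 * (g z.1 * g z.2) := by
    funext z; ring
  have e1 : ∫ z : α × α, g z.1 ^ 2 ∂(P.prod P) = ∫ x, g x ^ 2 ∂P := by
    simpa using integral_fun_fst (μ := P) (ν := P) (fun x => g x ^ 2)
  have e2 : ∫ z : α × α, g z.2 ^ 2 ∂(P.prod P) = ∫ x, g x ^ 2 ∂P := by
    simpa using integral_fun_snd (μ := P) (ν := P) (fun x => g x ^ 2)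
  rw [e, integral_sub (h1.fun_add h2) (h3.const_mul 2), integral_add h1 h2, integral_const_mul,
    integral_prod_mul, e1, e2, variance_eq_sub hg]
  simp only [Pi.pow_apply]
  ring

/-- Law of total variance on a product space. -/
theorem variance_prod_eq {P : Measure α} {Q : Measure β} [IsProbabilityMeasure P]
    [IsProbabilityMeasure Q] {g : α × β → ℝ} (hg : MemLp g 2 (P.prod Q)) :
    MemLp (fun x => ∫ y, g (x, y) ∂Q) 2 P ∧
    Var[g; P.prod Q] =
      ∫ x, Var[fun y => g (x, y); Q] ∂P + Var[fun x => ∫ y, g (x, y) ∂Q; P] := by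
  have hsq : Integrable (fun z => g z ^ 2) (P.prod Q) := hg.integrable_sq
  have hi : Integrable g (P.prod Q) := hg.integrable (by norm_num)
  have hsec : ∀ᵐ x ∂P, MemLp (fun y => g (x, y)) 2 Q := by
    filter_upwards [hsq.prod_right_ae, hi.prod_right_ae] with x hx hx'
    exact (memLp_two_iff_integrable_sq hx'.aestronglyMeasurable).2 hx
  have hvar : ∀ᵐ x ∂P, Var[fun y => g (x, y); Q]
      = (∫ y, g (x, y) ^ 2 ∂Q) - (∫ y, g (x, y) ∂Q) ^ 2 := by
    filter_upwards [hsec] with x hx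
    rw [variance_eq_sub hx]; rfl
  have hGm : AEStronglyMeasurable (fun x => ∫ y, g (x, y) ∂Q) P :=
    hi.integral_prod_left.aestronglyMeasurable
  have hG : MemLp (fun x => ∫ y, g (x, y) ∂Q) 2 P := by
    refine (memLp_two_iff_integrable_sq hGm).2 ?_
    refine hsq.integral_prod_left.mono' (hGm.pow 2) ?_
    filter_upwards [hsec] with x hx
    rw [Real.norm_of_nonneg (sq_nonneg _)]
    exact sq_integral_le_integral_sq hx
  refine ⟨hG, ?_⟩
  rw [variance_eq_sub hg, variance_eq_sub hG, integral_congr_ae hvar,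
    integral_sub hsq.integral_prod_left hG.integrable_sq]
  simp only [Pi.pow_apply]
  rw [integral_prod _ hsq, integral_prod _ hi]
  ring

/-- Two independent copies, together with `(b + b')² ≤ 2 (b² + b'²)`. -/
theorem variance_le_of_abs_sub_le {P : Measure α} [IsProbabilityMeasure P] {g b : α → ℝ}
    (hg : MemLp g 2 P) (hb : MemLp b 2 P) (h : ∀ x y, |g x - g y| ≤ b x + b y) :
    Var[g; P] ≤ 2 * ∫ x, b x ^ 2 ∂P := by
  have h1 : Integrable (fun z : α × α => b z.1 ^ 2) (P.prod P) := hb.integrable_sq.comp_fst P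
  have h2 : Integrable (fun z : α × α => b z.2 ^ 2) (P.prod P) := hb.integrable_sq.comp_snd P
  have e1 : ∫ z : α × α, b z.1 ^ 2 ∂(P.prod P) = ∫ x, b x ^ 2 ∂P := by
    simpa using integral_fun_fst (μ := P) (ν := P) (fun x => b x ^ 2)
  have e2 : ∫ z : α × α, b z.2 ^ 2 ∂(P.prod P) = ∫ x, b x ^ 2 ∂P := by
    simpa using integral_fun_snd (μ := P) (ν := P) (fun x => b x ^ 2)
  have key : ∫ z : α × α, (g z.1 - g z.2) ^ 2 ∂(P.prod P)
      ≤ ∫ z : α × α, 2 * (b z.1 ^ 2 + b z.2 ^ 2) ∂(P.prod P) := by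
    refine integral_mono_of_nonneg (Filter.Eventually.of_forall fun z => sq_nonneg _)
      ((h1.add h2).const_mul 2) (Filter.Eventually.of_forall fun z => ?_)
    have hz := h z.1 z.2
    have : (g z.1 - g z.2) ^ 2 ≤ (b z.1 + b z.2) ^ 2 := by
      rw [← sq_abs (g z.1 - g z.2)]
      exact pow_le_pow_left₀ (abs_nonneg _) hz 2
    simp only
    nlinarith [sq_nonneg (b z.1 - b z.2)]
  rw [← two_mul_variance_eq hg, integral_const_mul, integral_add h1 h2, e1, e2] at key
  linarith

/-- A variance bound for functions of independent variables whose increments in each variable are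
controlled: a consequence of the Efron–Stein inequality. -/
theorem memLp_and_variance_pi_le {P : Measure α} [IsProbabilityMeasure P] {b : α → ℝ}
    (hb : MemLp b 2 P) (n : ℕ) (g : (Fin n → α) → ℝ) (hg : Measurable g)
    (hdiff : ∀ x i y, |g (Function.update x i y) - g x| ≤ b y + b (x i)) :
    MemLp g 2 (Measure.pi fun _ : Fin n => P) ∧
      Var[g; Measure.pi fun _ : Fin n => P] ≤ 2 * n * ∫ x, b x ^ 2 ∂P := by
  induction n with
  | zero =>
    have hc : g = fun _ => g default := by
      funext x; rw [Subsingleton.elim x default]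
    rw [hc]
    refine ⟨memLp_const _, ?_⟩
    rw [variance_eq_sub (memLp_const _)]
    simp
  | succ n ih =>
    -- The base point `c` serves for square integrability: `|h (x, y)| ≤ |h (c, y)| + b x + b c`.
    obtain ⟨c⟩ : Nonempty α := P.nonempty_of_neZero
    set e := (MeasurableEquiv.piFinSuccAbove (fun _ : Fin (n + 1) => α) 0).symm
    have he : MeasurePreserving e (P.prod (Measure.pi fun _ : Fin n => P))
        (Measure.pi fun _ : Fin (n + 1) => P) :=
      (measurePreserving_piFinSuccAbove (fun _ : Fin (n + 1) => P) 0).symm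
    have hcons : ∀ x y, e (x, y) = Fin.cons x y := fun x y => by
      simp [e, MeasurableEquiv.piFinSuccAbove, Fin.insertNthEquiv]
    set h : α × (Fin n → α) → ℝ := fun z => g (e z)
    have hm : Measurable h := hg.comp e.measurable
    have hsec : ∀ x, MemLp (fun y => h (x, y)) 2 (Measure.pi fun _ : Fin n => P) ∧
        Var[fun y => h (x, y); Measure.pi fun _ : Fin n => P] ≤ 2 * n * ∫ x, b x ^ 2 ∂P := by
      intro x
      refine ih _ (hm.comp measurable_prodMk_left) fun y i y' => ?_
      have := hdiff (Fin.cons x y) i.succ y'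
      simpa [h, hcons, Fin.cons_update] using this
    have hfst : ∀ x x' y, |h (x, y) - h (x', y)| ≤ b x + b x' := by
      intro x x' y
      have := hdiff (Fin.cons x' y) 0 x
      simpa [h, hcons] using this
    have hL : MemLp h 2 (P.prod (Measure.pi fun _ : Fin n => P)) := by
      have h1 : MemLp (fun z : α × (Fin n → α) => h (c, z.2)) 2
          (P.prod (Measure.pi fun _ : Fin n => P)) := (hsec c).1.comp_snd P
      have h2 : MemLp (fun z : α × (Fin n → α) => b z.1) 2
          (P.prod (Measure.pi fun _ : Fin n => P)) := hb.comp_fst _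
      refine ((h1.norm.add h2).add (memLp_const (b c))).mono' hm.aestronglyMeasurable
        (Filter.Eventually.of_forall fun z => ?_)
      have := hfst z.1 c z.2
      have h3 := abs_sub_abs_le_abs_sub (h (z.1, z.2)) (h (c, z.2))
      simp only [Real.norm_eq_abs, Pi.add_apply]
      change |h (z.1, z.2)| ≤ _
      linarith
    refine ⟨by
      rw [← he.map_eq]
      exact (memLp_map_measure_iff hg.aestronglyMeasurable e.measurable.aemeasurable).2 hL, ?_⟩
    rw [← he.variance_fun_comp hg.aemeasurable]
    change Var[h; _] ≤ _
    -- Total variance: the fibres contribute `2 n ∫ b²` by induction. Averaging over the last `n`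
    -- coordinates preserves the increment bound in the first one, which contributes the remaining
    -- `2 ∫ b²`.
    obtain ⟨hG, hvar⟩ := variance_prod_eq hL
    rw [hvar]
    have hA : ∫ x, Var[fun y => h (x, y); Measure.pi fun _ : Fin n => P] ∂P
        ≤ 2 * n * ∫ x, b x ^ 2 ∂P := by
      calc _ ≤ ∫ _, 2 * n * ∫ x, b x ^ 2 ∂P ∂P :=
            integral_mono_of_nonneg (Filter.Eventually.of_forall fun x => variance_nonneg _ _)
              (integrable_const _) (Filter.Eventually.of_forall fun x => (hsec x).2)
        _ = _ := by simp
    have hB : Var[fun x => ∫ y, h (x, y) ∂(Measure.pi fun _ : Fin n => P); P]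
        ≤ 2 * ∫ x, b x ^ 2 ∂P := by
      refine variance_le_of_abs_sub_le hG hb fun x x' => ?_
      rw [← integral_sub ((hsec x).1.integrable (by norm_num))
        ((hsec x').1.integrable (by norm_num))]
      have := norm_integral_le_of_norm_le_const
        (μ := Measure.pi fun _ : Fin n => P) (f := fun y => h (x, y) - h (x', y))
        (Filter.Eventually.of_forall fun y => hfst x x' y)
      simpa using this
    push_cast
    linarith

/-- Pythagoras' theorem for orthonormal random variables. -/
theorem integral_sq_sum_mul_eq {P : Measure α} {ι : Type*} [Fintype ι]
    [DecidableEq ι] {X : ι → α → ℝ} (hX : ∀ j, MemLp (X j) 2 P)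
    (horth : ∀ i j, ∫ x, X i x * X j x ∂P = if i = j then 1 else 0) (c : ι → ℝ) :
    ∫ x, (∑ j, c j * X j x) ^ 2 ∂P = ∑ j, c j ^ 2 := by
  have hXX : ∀ i j, Integrable (fun x => X i x * X j x) P :=
    fun i j => (hX i).integrable_mul (hX j)
  have : (fun x => (∑ j, c j * X j x) ^ 2)
      = fun x => ∑ i, ∑ j, c i * c j * (X i x * X j x) := by
    funext x; rw [sq, Finset.sum_mul_sum]
    exact Finset.sum_congr rfl fun i _ => Finset.sum_congr rfl fun j _ => by ring
  rw [this, integral_finsetSum _ fun i _ => integrable_finsetSum _ fun j _ =>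
    (hXX i j).const_mul _]
  refine Finset.sum_congr rfl fun i _ => ?_
  rw [integral_finsetSum _ fun j _ => (hXX i j).const_mul _]
  simp_rw [integral_const_mul, horth]
  simp [sq]

/-- Bessel's inequality for random variables. -/
theorem sum_sq_integral_mul_le {P : Measure α} [IsProbabilityMeasure P] {ι : Type*} [Fintype ι]
    [DecidableEq ι] {q : α → ℝ} {X : ι → α → ℝ} (hq : MemLp q 2 P) (hX : ∀ j, MemLp (X j) 2 P)
    (horth : ∀ i j, ∫ x, X i x * X j x ∂P = if i = j then 1 else 0) :
    ∑ j, (∫ x, q x * X j x ∂P) ^ 2 ≤ ∫ x, q x ^ 2 ∂P := by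
  set c : ι → ℝ := fun j => ∫ x, q x * X j x ∂P
  have hS : MemLp (fun x => ∑ j, c j * X j x) 2 P :=
    memLp_finsetSum _ fun j _ => (hX j).const_mul (c j)
  have hqX : ∀ j, Integrable (fun x => q x * X j x) P := fun j => hq.integrable_mul (hX j)
  have h1 : ∫ x, q x * ∑ j, c j * X j x ∂P = ∑ j, c j ^ 2 := by
    have : (fun x => q x * ∑ j, c j * X j x) = fun x => ∑ j, c j * (q x * X j x) := by
      funext x; rw [Finset.mul_sum]; exact Finset.sum_congr rfl fun j _ => by ring
    rw [this, integral_finsetSum _ fun j _ => (hqX j).const_mul _]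
    exact Finset.sum_congr rfl fun j _ => by rw [integral_const_mul, sq]
  have h2 : ∫ x, (∑ j, c j * X j x) ^ 2 ∂P = ∑ j, c j ^ 2 := integral_sq_sum_mul_eq hX horth c
  -- The squared distance from `q` to its orthogonal projection on the span of the `X j`.
  have h3 : 0 ≤ ∫ x, (q x - ∑ j, c j * X j x) ^ 2 ∂P := integral_nonneg fun x => sq_nonneg _
  have e : (fun x => (q x - ∑ j, c j * X j x) ^ 2)
      = fun x => q x ^ 2 - 2 * (q x * ∑ j, c j * X j x) + (∑ j, c j * X j x) ^ 2 := by
    funext x; ring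
  have i1 : Integrable (fun x => q x * ∑ j, c j * X j x) P := hq.integrable_mul hS
  have i2 : Integrable (fun x => q x ^ 2 - 2 * (q x * ∑ j, c j * X j x)) P :=
    hq.integrable_sq.sub (i1.const_mul 2)
  rw [e, integral_add i2 hS.integrable_sq,
    integral_sub hq.integrable_sq (i1.const_mul 2), integral_const_mul, h1, h2] at h3
  linarith

end VarianceTools

/-! ### The Gaussian Poincaré inequality by rotation -/

section GaussianPoincare

variable {E : Type*} [NormedAddCommGroup E] [NormedSpace ℝ E] [SecondCountableTopology E]
  [MeasurableSpace E] [BorelSpace E]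

/-- A Poincaré inequality for measures whose square is invariant under rotations, by integration
along the rotation path. -/
theorem variance_le_of_hasDerivAt_rotation {μ : Measure E} [IsProbabilityMeasure μ]
    (hrot : ∀ θ : ℝ, (μ.prod μ).map (ContinuousLinearMap.rotation θ) = μ.prod μ)
    {G : E → ℝ} {H : E × E → ℝ} (hG : MemLp G 2 μ) (hH : Measurable H)
    (hH2 : Integrable (fun z => H z ^ 2) (μ.prod μ))
    (hderiv : ∀ (z : E × E) (θ : ℝ), HasDerivAt
      (fun θ => G (ContinuousLinearMap.rotation θ z).1) (H (ContinuousLinearMap.rotation θ z)) θ)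
    (hbdd : ∀ z : E × E, ∃ B, ∀ θ : ℝ, |H (ContinuousLinearMap.rotation θ z)| ≤ B) :
    Var[G; μ] ≤ Real.pi ^ 2 / 8 * ∫ z, H z ^ 2 ∂(μ.prod μ) := by
  -- The angle is `π/2 · s` with `s` uniform on `(0, 1]`, so the path leads from `z.1` to `z.2` and
  -- Jensen's inequality costs no constant. The factor `(π/2)²` and the half from the two-copy
  -- formula make `π²/8`.
  set U : Measure ℝ := volume.restrict (Set.Ioc 0 1)
  have : IsProbabilityMeasure U := ⟨by simp [U]⟩
  have hjoint : Measurable fun q : (E × E) × ℝ =>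
      H (ContinuousLinearMap.rotation (Real.pi / 2 * q.2) q.1) := by
    refine hH.comp ?_
    simp only [ContinuousLinearMap.rotation_apply]
    fun_prop
  have hmemLp : ∀ z, MemLp (fun s : ℝ => Real.pi / 2 *
      H (ContinuousLinearMap.rotation (Real.pi / 2 * s) z)) 2 U := by
    intro z
    obtain ⟨B, hB⟩ := hbdd z
    refine MemLp.const_mul (MemLp.of_bound
      (hjoint.comp measurable_prodMk_left).aestronglyMeasurable B ?_) _
    exact Filter.Eventually.of_forall fun s => hB _
  have hFTC : ∀ z : E × E, G z.2 - G z.1 = ∫ s, Real.pi / 2 *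
      H (ContinuousLinearMap.rotation (Real.pi / 2 * s) z) ∂U := by
    intro z
    have hd : ∀ s : ℝ, HasDerivAt
        (fun s => G (ContinuousLinearMap.rotation (Real.pi / 2 * s) z).1)
        (Real.pi / 2 * H (ContinuousLinearMap.rotation (Real.pi / 2 * s) z)) s := by
      intro s
      have h1 : HasDerivAt (fun s : ℝ => Real.pi / 2 * s) (Real.pi / 2) s := by
        simpa using (hasDerivAt_id s).const_mul (Real.pi / 2)
      have := (hderiv z (Real.pi / 2 * s)).comp s h1
      rw [mul_comm]; exact this
    have := intervalIntegral.integral_eq_sub_of_hasDerivAt (a := 0) (b := 1) (fun s _ => hd s)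
      ((intervalIntegrable_iff_integrableOn_Ioc_of_le zero_le_one).2
        ((hmemLp z).integrable (by norm_num)))
    rw [intervalIntegral.integral_of_le zero_le_one] at this
    rw [this]
    simp [ContinuousLinearMap.rotation_apply]
  -- With lower integrals, the exchange of `s` and `z` is Tonelli's theorem and needs only
  -- measurability. Rotation invariance then removes the angle.
  have hpt : ∀ z : E × E, ENNReal.ofReal ((G z.1 - G z.2) ^ 2) ≤ ∫⁻ s, ENNReal.ofReal
      ((Real.pi / 2 * H (ContinuousLinearMap.rotation (Real.pi / 2 * s) z)) ^ 2) ∂U := by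
    intro z
    rw [← ofReal_integral_eq_lintegral_ofReal (hmemLp z).integrable_sq
      (Filter.Eventually.of_forall fun s => sq_nonneg _)]
    refine ENNReal.ofReal_le_ofReal ?_
    rw [sub_sq_comm, hFTC z]
    exact sq_integral_le_integral_sq (hmemLp z)
  have hinv : ∀ θ : ℝ, ∫⁻ z, ENNReal.ofReal
      ((Real.pi / 2 * H (ContinuousLinearMap.rotation θ z)) ^ 2) ∂(μ.prod μ)
      = ∫⁻ z, ENNReal.ofReal ((Real.pi / 2 * H z) ^ 2) ∂(μ.prod μ) := by
    intro θ
    conv_rhs => rw [← hrot θ]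
    rw [lintegral_map (by fun_prop) (ContinuousLinearMap.continuous _).measurable]
  have hle : ∫⁻ z, ENNReal.ofReal ((G z.1 - G z.2) ^ 2) ∂(μ.prod μ)
      ≤ ENNReal.ofReal (∫ z, (Real.pi / 2 * H z) ^ 2 ∂(μ.prod μ)) := by
    have hint : Integrable (fun z => (Real.pi / 2 * H z) ^ 2) (μ.prod μ) := by
      simp_rw [mul_pow]; exact hH2.const_mul _
    rw [ofReal_integral_eq_lintegral_ofReal hint
      (Filter.Eventually.of_forall fun s => sq_nonneg _)]
    refine (lintegral_mono hpt).trans ?_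
    rw [lintegral_lintegral_swap]
    · simp_rw [hinv]; simp
    · exact (ENNReal.measurable_ofReal.comp ((hjoint.const_mul _).pow_const 2)).aemeasurable
  have h0 : 0 ≤ ∫ z, (Real.pi / 2 * H z) ^ 2 ∂(μ.prod μ) := integral_nonneg fun z => sq_nonneg _
  have hfin : ∫ z : E × E, (G z.1 - G z.2) ^ 2 ∂(μ.prod μ)
      ≤ ∫ z, (Real.pi / 2 * H z) ^ 2 ∂(μ.prod μ) := by
    have hm : AEStronglyMeasurable (fun z : E × E => (G z.1 - G z.2) ^ 2) (μ.prod μ) :=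
      ((hG.comp_fst μ).aestronglyMeasurable.sub (hG.comp_snd μ).aestronglyMeasurable).pow 2
    rw [integral_eq_lintegral_of_nonneg_ae (Filter.Eventually.of_forall fun z => sq_nonneg _) hm]
    exact ENNReal.toReal_le_of_le_ofReal h0 hle
  rw [← two_mul_variance_eq hG] at hfin
  simp_rw [mul_pow] at hfin
  rw [integral_const_mul] at hfin
  linarith

end GaussianPoincare

/-! ### Gaussian vectors and arrays: symmetry and second moments -/

section GaussianFacts

instance (m : ℕ) : IsProbabilityMeasure (gaussVec m) := by
  unfold gaussVec; infer_instance

instance (m l : ℕ) : IsProbabilityMeasure (gaussMat m l) := by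
  unfold gaussMat; infer_instance

instance (d p n : ℕ) : IsProbabilityMeasure (prior d p n) := by
  unfold prior; infer_instance

instance {k : ℕ} (d p n : ℕ) (PA : Measure (Fin k → ℝ)) [IsProbabilityMeasure PA] :
    IsProbabilityMeasure (disorderLaw d p n PA) := by
  unfold disorderLaw; infer_instance

/-- Independent Gaussian variables are jointly Gaussian; here they are the coordinates, whose joint
map is the identity. -/
theorem isGaussian_pi {ι : Type*} [Fintype ι] {E : ι → Type*} [∀ i, NormedAddCommGroup (E i)]
    [∀ i, NormedSpace ℝ (E i)] [∀ i, MeasurableSpace (E i)] [∀ i, CompleteSpace (E i)]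
    [∀ i, BorelSpace (E i)] [∀ i, SecondCountableTopology (E i)] (μ : ∀ i, Measure (E i))
    [∀ i, IsGaussian (μ i)] : IsGaussian (Measure.pi μ) := by
  have hX : iIndepFun (fun i (ω : ∀ i, E i) => ω i) (Measure.pi μ) :=
    iIndepFun_pi (X := fun i (x : E i) => x) fun i => aemeasurable_id
  have h := hX.hasGaussianLaw fun i => ⟨by
    rw [(measurePreserving_eval μ i).map_eq]; infer_instance⟩
  simpa using h.isGaussian_map

instance (m : ℕ) : IsGaussian (gaussVec m) := isGaussian_pi _

instance (m l : ℕ) : IsGaussian (gaussMat m l) := isGaussian_pi _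

instance : (gaussianReal 0 1).IsNegInvariant :=
  ⟨by
    have := gaussianReal_map_neg (μ := 0) (v := 1)
    simpa [Measure.neg] using this⟩

instance (m : ℕ) : (gaussVec m).IsNegInvariant := by
  unfold gaussVec; infer_instance

instance (m l : ℕ) : (gaussMat m l).IsNegInvariant :=
  Measure.pi.isNegInvariant (fun _ : Fin m => gaussVec l)

/-- The law of the teacher's inner weights `(W*, v*)`. -/
def weightLaw (d p : ℕ) : Measure ((Fin p → Fin d → ℝ) × (Fin d → ℝ)) :=
  (gaussMat p d).prod (gaussVec d)

instance (d p : ℕ) : IsGaussian (weightLaw d p) := by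
  unfold weightLaw; infer_instance

theorem map_neg_weightLaw (d p : ℕ) :
    MeasurePreserving (fun w => -w) (weightLaw d p) (weightLaw d p) :=
  (Measure.measurePreserving_neg (gaussMat p d)).prod (Measure.measurePreserving_neg (gaussVec d))

/-- Two independent copies of a centred Gaussian vector have a rotation-invariant law. Centring
follows from the symmetry `w ↦ -w`: the mean equals its own opposite. -/
theorem map_rotation_weightLaw (d p : ℕ) (θ : ℝ) :
    ((weightLaw d p).prod (weightLaw d p)).map (ContinuousLinearMap.rotation θ)
      = (weightLaw d p).prod (weightLaw d p) := by
  refine IsGaussian.map_rotation_eq_self ?_ θ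
  have h := (map_neg_weightLaw d p).integral_comp' (f := MeasurableEquiv.neg _) id
  exact self_eq_neg.1 (h.symm.trans (integral_neg _))

theorem integral_sq_gaussianReal : ∫ x, x * x ∂(gaussianReal 0 1) = 1 := by
  have h := variance_fun_id_gaussianReal (μ := 0) (v := 1)
  rw [variance_eq_integral (by fun_prop), integral_id_gaussianReal] at h
  simpa [sq] using h

theorem integral_pi_eval_mul_eval {ι α : Type*} [Fintype ι] [MeasurableSpace α]
    (P : Measure α) [IsProbabilityMeasure P] {f g : α → ℝ} (hf : Measurable f) (hg : Measurable g)
    {i j : ι} (hij : i ≠ j) :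
    ∫ x, f (x i) * g (x j) ∂(Measure.pi fun _ : ι => P) = (∫ x, f x ∂P) * ∫ x, g x ∂P := by
  have hX : iIndepFun (fun i (ω : ι → α) => ω i) (Measure.pi fun _ : ι => P) :=
    iIndepFun_pi (X := fun i (x : α) => x) fun i => aemeasurable_id
  have h := (hX.indepFun hij).comp hf hg
  have e := h.integral_fun_mul_eq_mul_integral
    (hf.comp (measurable_pi_apply i)).aestronglyMeasurable
    (hg.comp (measurable_pi_apply j)).aestronglyMeasurable
  simp only [Function.comp_apply] at e
  rw [e, integral_comp_eval (μ := fun _ : ι => P) hf.aestronglyMeasurable,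
    integral_comp_eval (μ := fun _ : ι => P) hg.aestronglyMeasurable]

theorem memLp_gaussVec_eval {m : ℕ} (j : Fin m) : MemLp (fun x : Fin m → ℝ => x j) 2 (gaussVec m) :=
  (memLp_id_gaussianReal' (μ := 0) (v := 1) 2 (by norm_num)).comp_measurePreserving
    (measurePreserving_eval (fun _ : Fin m => gaussianReal 0 1) j)

theorem integral_gaussVec_eval {m : ℕ} (j : Fin m) : ∫ x, x j ∂(gaussVec m) = 0 := by
  have := integral_comp_eval (μ := fun _ : Fin m => gaussianReal 0 1) (i := j)
    (f := fun x : ℝ => x) (by fun_prop)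
  rw [integral_id_gaussianReal] at this
  exact this

theorem integral_gaussVec_eval_mul_eval {m : ℕ} (i j : Fin m) :
    ∫ x, x i * x j ∂(gaussVec m) = if i = j then 1 else 0 := by
  split_ifs with h
  · subst h
    have := integral_comp_eval (μ := fun _ : Fin m => gaussianReal 0 1) (i := i)
      (f := fun x : ℝ => x * x) (by fun_prop)
    rw [integral_sq_gaussianReal] at this
    exact this
  · have := integral_pi_eval_mul_eval (gaussianReal 0 1) measurable_id measurable_id h
    simp only [id, integral_id_gaussianReal, mul_zero] at this
    exact this

theorem memLp_gaussMat_eval {m l : ℕ} (i : Fin m) (j : Fin l) :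
    MemLp (fun x : Fin m → Fin l → ℝ => x i j) 2 (gaussMat m l) :=
  (memLp_gaussVec_eval j).comp_measurePreserving
    (measurePreserving_eval (fun _ : Fin m => gaussVec l) i)

theorem integral_gaussMat_eval_mul_eval {m l : ℕ} (q r : Fin m × Fin l) :
    ∫ x, x q.1 q.2 * x r.1 r.2 ∂(gaussMat m l) = if q = r then 1 else 0 := by
  obtain ⟨i, j⟩ := q
  obtain ⟨i', j'⟩ := r
  by_cases h : i = i'
  · subst h
    have := integral_comp_eval (μ := fun _ : Fin m => gaussVec l) (i := i)
      (f := fun x : Fin l → ℝ => x j * x j') (by fun_prop)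
    rw [integral_gaussVec_eval_mul_eval] at this
    simpa [gaussMat] using this
  · have := integral_pi_eval_mul_eval (gaussVec l) (measurable_pi_apply j)
      (measurable_pi_apply j') h
    rw [integral_gaussVec_eval, zero_mul] at this
    simpa [h, gaussMat] using this

end GaussianFacts

/-! ### Regrouping the disorder by samples -/

section Regrouping

/-- The disorder attached to one sample: `(ξ_μ, X_μ, A_μ, Z_μ)`. -/
abbrev Sample (d k : ℕ) : Type := ℝ × (Fin d → ℝ) × (Fin k → ℝ) × ℝ

/-- The law of the disorder attached to one sample. -/
def sampleLaw {k : ℕ} (d : ℕ) (PA : Measure (Fin k → ℝ)) : Measure (Sample d k) :=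
  (gaussianReal 0 1).prod ((gaussVec d).prod (PA.prod (gaussianReal 0 1)))

instance {k : ℕ} (d : ℕ) (PA : Measure (Fin k → ℝ)) [IsProbabilityMeasure PA] :
    IsProbabilityMeasure (sampleLaw d PA) := by
  unfold sampleLaw; infer_instance

/-- The law of the samples. -/
def samplesLaw {k : ℕ} (d n : ℕ) (PA : Measure (Fin k → ℝ)) : Measure (Fin n → Sample d k) :=
  Measure.pi fun _ => sampleLaw d PA

instance {k : ℕ} (d n : ℕ) (PA : Measure (Fin k → ℝ)) [IsProbabilityMeasure PA] :
    IsProbabilityMeasure (samplesLaw d n PA) := by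
  unfold samplesLaw; infer_instance

/-- The disorder built from the inner weights and the samples. -/
def toDisorder {d p n k : ℕ}
    (q : ((Fin p → Fin d → ℝ) × (Fin d → ℝ)) × (Fin n → Sample d k)) : Disorder d p n k :=
  (q.1.1, q.1.2, fun μ => (q.2 μ).1, fun μ => (q.2 μ).2.1, fun μ => (q.2 μ).2.2.1,
    fun μ => (q.2 μ).2.2.2)

/-- An `n`-tuple of quadruples is turned into a quadruple of `n`-tuples by splitting off one
component at a time. In the regrouped form the samples are i.i.d. coordinates, as the Efron–Stein
bound requires. -/
theorem measurePreserving_toDisorder {k : ℕ} (d p n : ℕ) (PA : Measure (Fin k → ℝ))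
    [IsProbabilityMeasure PA] :
    MeasurePreserving toDisorder ((weightLaw d p).prod (samplesLaw d n PA))
      (disorderLaw d p n PA) := by
  have h3 := measurePreserving_arrowProdEquivProdArrow (Fin k → ℝ) ℝ (Fin n)
    (fun _ => PA) (fun _ => gaussianReal 0 1)
  have h2 := measurePreserving_arrowProdEquivProdArrow (Fin d → ℝ) ((Fin k → ℝ) × ℝ) (Fin n)
    (fun _ => gaussVec d) (fun _ => PA.prod (gaussianReal 0 1))
  have h1 := measurePreserving_arrowProdEquivProdArrow ℝ ((Fin d → ℝ) × (Fin k → ℝ) × ℝ) (Fin n)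
    (fun _ => gaussianReal 0 1) (fun _ => (gaussVec d).prod (PA.prod (gaussianReal 0 1)))
  have h2' := ((MeasurePreserving.id (Measure.pi fun _ : Fin n => gaussVec d)).prod h3).comp h2
  have h1' := ((MeasurePreserving.id
    (Measure.pi fun _ : Fin n => gaussianReal 0 1)).prod h2').comp h1
  have h0 := (MeasurePreserving.id (weightLaw d p)).prod h1'
  exact (measurePreserving_prodAssoc (gaussMat p d) (gaussVec d) _).comp h0

end Regrouping

/-! ### The output channel and its score -/

section Channel

/-- A readout that is differentiable in its first argument, with values and derivatives bounded
by `K`, for every value of its second argument. -/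
structure ReadoutBound {k : ℕ} (f : ℝ → (Fin k → ℝ) → ℝ) (K : ℝ) : Prop where
  measurable : Measurable (Function.uncurry f)
  differentiable : ∀ A, Differentiable ℝ fun x => f x A
  bdd : ∀ x A, |f x A| ≤ K
  bdd_deriv : ∀ x A, |deriv (fun x => f x A) x| ≤ K

variable {k : ℕ} {PA : Measure (Fin k → ℝ)} {f : ℝ → (Fin k → ℝ) → ℝ} {K Δ : ℝ}

theorem ReadoutBound.nonneg (hf : ReadoutBound f K) : 0 ≤ K :=
  (abs_nonneg _).trans (hf.bdd 0 0)

/-- Joint measurability: the derivative is the pointwise limit of difference quotients, each jointly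
measurable in `(x, A)`. -/
theorem ReadoutBound.measurable_deriv (hf : ReadoutBound f K) :
    Measurable fun q : ℝ × (Fin k → ℝ) => deriv (fun x => f x q.2) q.1 := by
  let u : ℕ → ℝ := fun m => 1 / ((m : ℝ) + 1)
  have hu : Filter.Tendsto u Filter.atTop (nhdsWithin 0 {0}ᶜ) := by
    refine tendsto_nhdsWithin_iff.2 ⟨tendsto_one_div_add_atTop_nhds_zero_nat, ?_⟩
    exact Filter.Eventually.of_forall fun m => by
      have : (0 : ℝ) < (m : ℝ) + 1 := by positivity
      simp [u, this.ne']
  refine measurable_of_tendsto_metrizable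
    (f := fun m (q : ℝ × (Fin k → ℝ)) => (u m)⁻¹ * (f (q.1 + u m) q.2 - f q.1 q.2)) ?_ ?_
  · intro m
    have h1 : Measurable fun q : ℝ × (Fin k → ℝ) => f (q.1 + u m) q.2 :=
      hf.measurable.comp ((measurable_fst.add_const _).prodMk measurable_snd)
    exact (h1.sub hf.measurable).const_mul _
  · rw [tendsto_pi_nhds]
    intro q
    have h := (hf.differentiable q.2 q.1).hasDerivAt
    rw [hasDerivAt_iff_tendsto_slope_zero] at h
    simpa [Function.comp_def] using h.comp hu

/-- The Gaussian weight `P_out` averages. -/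
def channelWeight (f : ℝ → (Fin k → ℝ) → ℝ) (Δ y x : ℝ) (A : Fin k → ℝ) : ℝ :=
  1 / √(2 * Real.pi * Δ) * Real.exp (-(1 / (2 * Δ)) * (y - f x A) ^ 2)

theorem Pout_eq (y x : ℝ) : Pout PA f Δ y x = ∫ A, channelWeight f Δ y x A ∂PA := rfl

variable [IsProbabilityMeasure PA]

theorem channelWeight_nonneg (f : ℝ → (Fin k → ℝ) → ℝ) (Δ y x : ℝ) (A : Fin k → ℝ) :
    0 ≤ channelWeight f Δ y x A := by
  unfold channelWeight; positivity

theorem channelWeight_le (hΔ : 0 < Δ) (y x : ℝ) (A : Fin k → ℝ) :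
    channelWeight f Δ y x A ≤ 1 / √(2 * Real.pi * Δ) := by
  unfold channelWeight
  refine mul_le_of_le_one_right (by positivity) (Real.exp_le_one_iff.2 ?_)
  have : 0 ≤ 1 / (2 * Δ) * (y - f x A) ^ 2 := by positivity
  linarith

theorem ReadoutBound.le_channelWeight (hf : ReadoutBound f K) (hΔ : 0 < Δ) (y x : ℝ)
    (A : Fin k → ℝ) : 1 / √(2 * Real.pi * Δ) * Real.exp (-((|y| + K) ^ 2 / (2 * Δ)))
      ≤ channelWeight f Δ y x A := by
  unfold channelWeight
  refine mul_le_mul_of_nonneg_left (Real.exp_le_exp.2 ?_) (by positivity)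
  have h1 : |y - f x A| ≤ |y| + K := (abs_sub _ _).trans (add_le_add_right (hf.bdd x A) _)
  have h2 : (y - f x A) ^ 2 ≤ (|y| + K) ^ 2 := by
    rw [← sq_abs (y - f x A)]; exact pow_le_pow_left₀ (abs_nonneg _) h1 2
  rw [neg_mul, neg_le_neg_iff, div_mul_eq_mul_div, one_mul]
  gcongr

theorem ReadoutBound.measurable_channelWeight (hf : ReadoutBound f K) (Δ : ℝ) :
    Measurable fun q : (ℝ × ℝ) × (Fin k → ℝ) => channelWeight f Δ q.1.1 q.1.2 q.2 := by
  have h : Measurable fun q : (ℝ × ℝ) × (Fin k → ℝ) => f q.1.2 q.2 :=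
    hf.measurable.comp ((measurable_snd.comp measurable_fst).prodMk measurable_snd)
  exact (Real.measurable_exp.comp (((measurable_fst.fst.sub h).pow_const 2).const_mul _)).const_mul _

theorem ReadoutBound.integrable_channelWeight (hf : ReadoutBound f K) (hΔ : 0 < Δ) (y x : ℝ) :
    Integrable (fun A => channelWeight f Δ y x A) PA := by
  refine Integrable.of_bound ((hf.measurable_channelWeight Δ).comp
    (measurable_prodMk_left (x := (y, x)))).aestronglyMeasurable (1 / √(2 * Real.pi * Δ)) ?_
  exact Filter.Eventually.of_forall fun A => by
    rw [Real.norm_of_nonneg (channelWeight_nonneg _ _ _ _ _)]; exact channelWeight_le hΔ y x A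

theorem ReadoutBound.measurable_Pout (hf : ReadoutBound f K) (Δ : ℝ) :
    Measurable fun q : ℝ × ℝ => Pout PA f Δ q.1 q.2 :=
  (hf.measurable_channelWeight Δ).stronglyMeasurable.integral_prod_right'.measurable

theorem ReadoutBound.measurable_logPout (hf : ReadoutBound f K) (Δ : ℝ) :
    Measurable fun q : ℝ × ℝ => logPout PA f Δ q.1 q.2 :=
  Real.measurable_log.comp (hf.measurable_Pout Δ)

theorem ReadoutBound.Pout_le (hf : ReadoutBound f K) (hΔ : 0 < Δ) (y x : ℝ) :
    Pout PA f Δ y x ≤ 1 / √(2 * Real.pi * Δ) := by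
  have := integral_mono (hf.integrable_channelWeight (PA := PA) hΔ y x)
    (integrable_const (1 / √(2 * Real.pi * Δ))) (fun A => channelWeight_le hΔ y x A)
  simpa [Pout_eq] using this

theorem ReadoutBound.le_Pout (hf : ReadoutBound f K) (hΔ : 0 < Δ) (y x : ℝ) :
    1 / √(2 * Real.pi * Δ) * Real.exp (-((|y| + K) ^ 2 / (2 * Δ))) ≤ Pout PA f Δ y x := by
  have := integral_mono (integrable_const _) (hf.integrable_channelWeight (PA := PA) hΔ y x)
    (fun A => hf.le_channelWeight hΔ y x A)
  simpa [Pout_eq] using this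

theorem ReadoutBound.Pout_pos (hf : ReadoutBound f K) (hΔ : 0 < Δ) (y x : ℝ) :
    0 < Pout PA f Δ y x :=
  lt_of_lt_of_le (by positivity) (hf.le_Pout hΔ y x)

/-- `P_out` lies between its maximal weight and that weight times a Gaussian factor in `|y| + K`.
The field `x` disappears from the bound because `f` is bounded. -/
theorem ReadoutBound.abs_logPout_le (hf : ReadoutBound f K) (hΔ : 0 < Δ) (y x : ℝ) :
    |logPout PA f Δ y x| ≤ |Real.log (1 / √(2 * Real.pi * Δ))| + (|y| + K) ^ 2 / (2 * Δ) := by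
  have h1 := Real.log_le_log (hf.Pout_pos (PA := PA) hΔ y x) (hf.Pout_le hΔ y x)
  have h2 := Real.log_le_log (by positivity) (hf.le_Pout (PA := PA) hΔ y x)
  rw [Real.log_mul (by positivity) (by positivity), Real.log_exp] at h2
  have h3 : 0 ≤ (|y| + K) ^ 2 / (2 * Δ) := by positivity
  have h4 := le_abs_self (Real.log (1 / √(2 * Real.pi * Δ)))
  have h5 := neg_abs_le (Real.log (1 / √(2 * Real.pi * Δ)))
  unfold logPout
  rw [abs_le]
  constructor <;> linarith

/-- The derivative of `P_out (y | x)` in `y`. -/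
def dPout (PA : Measure (Fin k → ℝ)) (f : ℝ → (Fin k → ℝ) → ℝ) (Δ y x : ℝ) : ℝ :=
  ∫ A, channelWeight f Δ y x A * (-(y - f x A) / Δ) ∂PA

theorem ReadoutBound.measurable_dPout (hf : ReadoutBound f K) (Δ : ℝ) :
    Measurable fun q : ℝ × ℝ => dPout PA f Δ q.1 q.2 := by
  have h : Measurable fun q : (ℝ × ℝ) × (Fin k → ℝ) => f q.1.2 q.2 :=
    hf.measurable.comp ((measurable_snd.comp measurable_fst).prodMk measurable_snd)
  have h' := hf.measurable_channelWeight Δ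
  have : Measurable fun q : (ℝ × ℝ) × (Fin k → ℝ) =>
      channelWeight f Δ q.1.1 q.1.2 q.2 * (-(q.1.1 - f q.1.2 q.2) / Δ) :=
    h'.mul ((measurable_fst.fst.sub h).neg.div_const Δ)
  exact this.stronglyMeasurable.integral_prod_right'.measurable

theorem ReadoutBound.abs_weight_factor_le (hf : ReadoutBound f K) (hΔ : 0 < Δ) (y x : ℝ)
    (A : Fin k → ℝ) : |-(y - f x A) / Δ| ≤ (|y| + K) / Δ := by
  rw [abs_div, abs_neg, abs_of_pos hΔ]
  gcongr
  exact (abs_sub _ _).trans (add_le_add_right (hf.bdd x A) _)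

theorem hasDerivAt_channelWeight (Δ y x : ℝ) (A : Fin k → ℝ) :
    HasDerivAt (fun y => channelWeight f Δ y x A)
      (channelWeight f Δ y x A * (-(y - f x A) / Δ)) y := by
  unfold channelWeight
  have h1 : HasDerivAt (fun y => -(1 / (2 * Δ)) * (y - f x A) ^ 2) (-(y - f x A) / Δ) y := by
    refine ((((hasDerivAt_id' y).sub_const (f x A)).fun_pow 2).const_mul
      (-(1 / (2 * Δ)))).congr_deriv ?_
    by_cases h : Δ = 0
    · simp [h]
    · field_simp; norm_num
  refine (h1.exp.const_mul (1 / √(2 * Real.pi * Δ))).congr_deriv ?_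
  ring

theorem ReadoutBound.hasDerivAt_Pout (hf : ReadoutBound f K) (hΔ : 0 < Δ) (y x : ℝ) :
    HasDerivAt (fun y => Pout PA f Δ y x) (dPout PA f Δ y x) y := by
  have hm := fun y => ((hf.measurable_channelWeight Δ).comp
    (measurable_prodMk_left (x := (y, x)))).aestronglyMeasurable (μ := PA)
  have hfm : Measurable fun A => f x A := hf.measurable.comp measurable_prodMk_left
  refine (hasDerivAt_integral_of_dominated_loc_of_deriv_le (𝕜 := ℝ) (μ := PA)
    (F := fun y A => channelWeight f Δ y x A)
    (F' := fun y A => channelWeight f Δ y x A * (-(y - f x A) / Δ))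
    -- On the unit ball around `y` the modulus is at most `|y| + 1`.
    (bound := fun _ => 1 / √(2 * Real.pi * Δ) * ((|y| + 1 + K) / Δ))
    (Metric.ball_mem_nhds y one_pos) (Filter.Eventually.of_forall hm)
    (hf.integrable_channelWeight hΔ y x) ?_ ?_ (integrable_const _) ?_).2
  · exact (hm y).mul (by fun_prop)
  · refine Filter.Eventually.of_forall fun A z hz => ?_
    rw [Metric.mem_ball, Real.dist_eq] at hz
    rw [norm_mul, Real.norm_of_nonneg (channelWeight_nonneg _ _ _ _ _)]
    refine mul_le_mul (channelWeight_le hΔ z x A) ((hf.abs_weight_factor_le hΔ z x A).trans ?_)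
      (norm_nonneg _) (by positivity)
    have := abs_sub_abs_le_abs_sub z y
    gcongr
    linarith
  · exact Filter.Eventually.of_forall fun A z _ => hasDerivAt_channelWeight Δ z x A

theorem ReadoutBound.abs_dPout_le (hf : ReadoutBound f K) (hΔ : 0 < Δ) (y x : ℝ) :
    |dPout PA f Δ y x| ≤ (|y| + K) / Δ * Pout PA f Δ y x := by
  rw [Pout_eq, ← integral_const_mul, ← Real.norm_eq_abs]
  refine norm_integral_le_of_norm_le ((hf.integrable_channelWeight (PA := PA) hΔ y x).const_mul _)
    (Filter.Eventually.of_forall fun A => ?_)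
  rw [norm_mul, Real.norm_of_nonneg (channelWeight_nonneg _ _ _ _ _), mul_comm]
  exact mul_le_mul_of_nonneg_right (hf.abs_weight_factor_le hΔ y x A)
    (channelWeight_nonneg _ _ _ _ _)

/-- The derivative of `log P_out (y | x)` in `y`. -/
def score (PA : Measure (Fin k → ℝ)) (f : ℝ → (Fin k → ℝ) → ℝ) (Δ y x : ℝ) : ℝ :=
  dPout PA f Δ y x / Pout PA f Δ y x

theorem ReadoutBound.measurable_score (hf : ReadoutBound f K) (Δ : ℝ) :
    Measurable fun q : ℝ × ℝ => score PA f Δ q.1 q.2 :=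
  (hf.measurable_dPout Δ).div (hf.measurable_Pout Δ)

theorem ReadoutBound.hasDerivAt_logPout (hf : ReadoutBound f K) (hΔ : 0 < Δ) (y x : ℝ) :
    HasDerivAt (fun y => logPout PA f Δ y x) (score PA f Δ y x) y :=
  (hf.hasDerivAt_Pout hΔ y x).log (hf.Pout_pos hΔ y x).ne'

/-- The score is the mean of `-(y - f x A) / Δ` under the law of `A` tilted by `channelWeight`, so
it inherits the pointwise bound of this factor. -/
theorem ReadoutBound.abs_score_le (hf : ReadoutBound f K) (hΔ : 0 < Δ) (y x : ℝ) :
    |score PA f Δ y x| ≤ (|y| + K) / Δ := by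
  unfold score
  rw [abs_div, abs_of_pos (hf.Pout_pos hΔ y x), div_le_iff₀ (hf.Pout_pos hΔ y x)]
  exact hf.abs_dPout_le hΔ y x

end Channel

/-! ### Logarithms of integrals of exponentials, and their gradient in the responses -/

section LogPartition

variable {Θ : Type*} [MeasurableSpace Θ] {π : Measure Θ} [IsProbabilityMeasure π]

/-- The map `u ↦ log ∫ exp u` is monotone and commutes with adding constants, hence is 1-Lipschitz
in the sup norm. -/
theorem abs_log_integral_exp_sub_le {u v : Θ → ℝ} {c : ℝ}
    (hu : Integrable (fun θ => Real.exp (u θ)) π) (hv : Integrable (fun θ => Real.exp (v θ)) π)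
    (h : ∀ θ, |u θ - v θ| ≤ c) :
    |Real.log (∫ θ, Real.exp (u θ) ∂π) - Real.log (∫ θ, Real.exp (v θ) ∂π)| ≤ c := by
  have key : ∀ {u v : Θ → ℝ}, Integrable (fun θ => Real.exp (u θ)) π →
      Integrable (fun θ => Real.exp (v θ)) π → (∀ θ, u θ ≤ c + v θ) →
      Real.log (∫ θ, Real.exp (u θ) ∂π) ≤ c + Real.log (∫ θ, Real.exp (v θ) ∂π) := by
    intro u v hu hv h
    rw [← Real.log_exp c, ← Real.log_mul (Real.exp_ne_zero _) (integral_exp_pos hv).ne',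
      ← integral_const_mul]
    refine Real.log_le_log (integral_exp_pos hu) (integral_mono hu (hv.const_mul _) fun θ => ?_)
    simp only
    rw [← Real.exp_add]
    exact Real.exp_le_exp.2 (h θ)
  rw [abs_le]
  constructor
  · have := key hv hu fun θ => by have := (abs_le.1 (h θ)).1; linarith
    linarith
  · have := key hu hv fun θ => by have := (abs_le.1 (h θ)).2; linarith
    linarith

variable {k : ℕ} {PA : Measure (Fin k → ℝ)} [IsProbabilityMeasure PA]
  {f : ℝ → (Fin k → ℝ) → ℝ} {K Δ : ℝ} {n : ℕ}

/-- The log-likelihood of the responses `Y` under the fields `s`. -/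
def logLik (PA : Measure (Fin k → ℝ)) (f : ℝ → (Fin k → ℝ) → ℝ) (Δ : ℝ) (Y s : Fin n → ℝ) : ℝ :=
  ∑ μ, logPout PA f Δ (Y μ) (s μ)

theorem ReadoutBound.measurable_logLik (hf : ReadoutBound f K) (Δ : ℝ) :
    Measurable fun q : (Fin n → ℝ) × (Fin n → ℝ) => logLik PA f Δ q.1 q.2 := by
  unfold logLik
  refine Finset.measurable_fun_sum _ fun μ _ => ?_
  exact (hf.measurable_logPout Δ).comp (f := fun q : (Fin n → ℝ) × (Fin n → ℝ) => (q.1 μ, q.2 μ))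
    (by fun_prop)

theorem ReadoutBound.exp_logLik_le (hf : ReadoutBound f K) (hΔ : 0 < Δ) (Y s : Fin n → ℝ) :
    Real.exp (logLik PA f Δ Y s) ≤ (1 / √(2 * Real.pi * Δ)) ^ n := by
  unfold logLik
  rw [Real.exp_sum]
  calc _ ≤ ∏ _μ : Fin n, (1 / √(2 * Real.pi * Δ)) :=
        Finset.prod_le_prod (fun μ _ => (Real.exp_pos _).le) fun μ _ => by
          unfold logPout
          rw [Real.exp_log (hf.Pout_pos hΔ _ _)]
          exact hf.Pout_le hΔ _ _
    _ = _ := by simp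

theorem ReadoutBound.integrable_exp_logLik (hf : ReadoutBound f K) (hΔ : 0 < Δ)
    (Y : Fin n → ℝ) {s : Θ → Fin n → ℝ} (hs : Measurable s) :
    Integrable (fun θ => Real.exp (logLik PA f Δ Y (s θ))) π := by
  refine Integrable.of_bound (Real.measurable_exp.comp ((hf.measurable_logLik Δ).comp
    (measurable_const.prodMk hs))).aestronglyMeasurable ((1 / √(2 * Real.pi * Δ)) ^ n) ?_
  exact Filter.Eventually.of_forall fun θ => by
    rw [Real.norm_of_nonneg (Real.exp_pos _).le]; exact hf.exp_logLik_le hΔ Y (s θ)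

/-- The posterior mean of the score of the `μ`-th response. -/
def meanScore (π : Measure Θ) (PA : Measure (Fin k → ℝ)) (f : ℝ → (Fin k → ℝ) → ℝ) (Δ : ℝ)
    (s : Θ → Fin n → ℝ) (Y : Fin n → ℝ) (μ : Fin n) : ℝ :=
  (∫ θ, Real.exp (logLik PA f Δ Y (s θ)) * score PA f Δ (Y μ) (s θ μ) ∂π) /
    ∫ θ, Real.exp (logLik PA f Δ Y (s θ)) ∂π

theorem ReadoutBound.abs_meanScore_le (hf : ReadoutBound f K) (hΔ : 0 < Δ)
    (Y : Fin n → ℝ) {s : Θ → Fin n → ℝ} (hs : Measurable s) (μ : Fin n) :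
    |meanScore π PA f Δ s Y μ| ≤ (|Y μ| + K) / Δ := by
  have hi := hf.integrable_exp_logLik (PA := PA) (π := π) hΔ Y hs
  have hpos := integral_exp_pos hi
  unfold meanScore
  rw [abs_div, abs_of_pos hpos, div_le_iff₀ hpos, ← integral_const_mul, ← Real.norm_eq_abs]
  refine norm_integral_le_of_norm_le (hi.const_mul _) (Filter.Eventually.of_forall fun θ => ?_)
  rw [norm_mul, Real.norm_of_nonneg (Real.exp_pos _).le, mul_comm]
  exact mul_le_mul_of_nonneg_right (hf.abs_score_le hΔ _ _) (Real.exp_pos _).le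

theorem ReadoutBound.hasFDerivAt_logLik (hf : ReadoutBound f K) (hΔ : 0 < Δ)
    (Y s : Fin n → ℝ) : HasFDerivAt (fun Y => logLik PA f Δ Y s)
      (∑ μ, score PA f Δ (Y μ) (s μ) • (ContinuousLinearMap.proj μ : (Fin n → ℝ) →L[ℝ] ℝ)) Y := by
  unfold logLik
  refine HasFDerivAt.fun_sum fun μ _ => ?_
  have h := hf.hasDerivAt_logPout (PA := PA) hΔ (Y μ) (s μ)
  exact HasDerivAt.comp_hasFDerivAt (h₂ := fun y => logPout PA f Δ y (s μ))
    (f := fun Y : Fin n → ℝ => Y μ) Y h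
    (ContinuousLinearMap.proj (R := ℝ) (φ := fun _ : Fin n => ℝ) μ).hasFDerivAt

/-- The gradient of a log-partition function is the Gibbs mean of the gradient of the exponent. On
the unit ball around `Y` the likelihood and the scores have bounds free of `θ`, which justifies
differentiation under the integral. -/
theorem ReadoutBound.hasFDerivAt_log_integral (hf : ReadoutBound f K) (hΔ : 0 < Δ)
    (Y : Fin n → ℝ) {s : Θ → Fin n → ℝ} (hs : Measurable s) :
    HasFDerivAt (fun Y => Real.log (∫ θ, Real.exp (logLik PA f Δ Y (s θ)) ∂π))
      (∑ μ, meanScore π PA f Δ s Y μ • (ContinuousLinearMap.proj μ : (Fin n → ℝ) →L[ℝ] ℝ)) Y := by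
  have hi := fun Y => hf.integrable_exp_logLik (PA := PA) (π := π) hΔ Y hs
  have hscore : ∀ (Y : Fin n → ℝ) μ, Measurable fun θ => score PA f Δ (Y μ) (s θ μ) :=
    fun Y μ => (hf.measurable_score Δ).comp (f := fun θ => (Y μ, s θ μ)) (by fun_prop)
  have hprod : ∀ μ, Integrable (fun θ => Real.exp (logLik PA f Δ Y (s θ)) *
      score PA f Δ (Y μ) (s θ μ)) π := fun μ =>
    (hi Y).mul_bdd (c := (|Y μ| + K) / Δ) (hscore Y μ).aestronglyMeasurable
      (Filter.Eventually.of_forall fun θ => hf.abs_score_le hΔ _ _)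
  have hK := hf.nonneg
  have hD := hasFDerivAt_integral_of_dominated_of_fderiv_le (𝕜 := ℝ) (μ := π)
    (F := fun Y θ => Real.exp (logLik PA f Δ Y (s θ)))
    (F' := fun Y θ => Real.exp (logLik PA f Δ Y (s θ)) • ∑ μ, score PA f Δ (Y μ) (s θ μ) •
      (ContinuousLinearMap.proj μ : (Fin n → ℝ) →L[ℝ] ℝ))
    (bound := fun _ => (1 / √(2 * Real.pi * Δ)) ^ n * ∑ μ, (|Y μ| + 1 + K) / Δ)
    (x₀ := Y) (Metric.ball_mem_nhds Y one_pos)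
    (Filter.Eventually.of_forall fun Y => (hi Y).aestronglyMeasurable) (hi Y) ?_ ?_
    (integrable_const _) ?_
  · have hZ := integral_exp_pos (hi Y)
    refine (hD.log hZ.ne').congr_fderiv (Eq.symm ?_)
    have e : ∀ θ, Real.exp (logLik PA f Δ Y (s θ)) • ∑ μ, score PA f Δ (Y μ) (s θ μ) •
        (ContinuousLinearMap.proj μ : (Fin n → ℝ) →L[ℝ] ℝ)
        = ∑ μ, (Real.exp (logLik PA f Δ Y (s θ)) * score PA f Δ (Y μ) (s θ μ)) •
          (ContinuousLinearMap.proj μ : (Fin n → ℝ) →L[ℝ] ℝ) := fun θ => by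
      rw [Finset.smul_sum]; simp_rw [smul_smul]
    simp_rw [e]
    rw [integral_finsetSum _ fun μ _ => (hprod μ).smul_const _, Finset.smul_sum]
    refine Finset.sum_congr rfl fun μ _ => ?_
    rw [integral_smul_const, smul_smul]
    unfold meanScore
    rw [div_eq_inv_mul]
  · refine (hi Y).aestronglyMeasurable.smul ?_
    refine Finset.aestronglyMeasurable_fun_sum _ fun μ _ => ?_
    exact (hscore Y μ).aestronglyMeasurable.smul_const _
  · refine Filter.Eventually.of_forall fun θ Y' hY' => ?_
    rw [norm_smul, Real.norm_of_nonneg (Real.exp_pos _).le]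
    refine mul_le_mul (hf.exp_logLik_le hΔ _ _) ((norm_sum_le _ _).trans
      (Finset.sum_le_sum fun μ _ => ?_)) (norm_nonneg _) (by positivity)
    rw [norm_smul]
    have hproj : ‖(ContinuousLinearMap.proj μ : (Fin n → ℝ) →L[ℝ] ℝ)‖ ≤ 1 :=
      ContinuousLinearMap.opNorm_le_bound _ zero_le_one fun x => by
        rw [one_mul]; exact norm_le_pi_norm x μ
    have h1 := hf.abs_score_le (PA := PA) hΔ (Y' μ) (s θ μ)
    have h2 : |Y' μ| ≤ |Y μ| + 1 := by
      have h3 : |Y' μ - Y μ| ≤ dist Y' Y := by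
        rw [← Real.dist_eq]; exact dist_le_pi_dist Y' Y μ
      have h4 := abs_sub_abs_le_abs_sub (Y' μ) (Y μ)
      have := Metric.mem_ball.1 hY'
      linarith
    calc _ ≤ (|Y' μ| + K) / Δ * 1 := mul_le_mul h1 hproj (norm_nonneg _) (by positivity)
      _ ≤ _ := by rw [mul_one]; gcongr
  · exact Filter.Eventually.of_forall fun θ Y' _ => (hf.hasFDerivAt_logLik hΔ Y' (s θ)).exp

end LogPartition

/-! ### Moments of the noise bounds -/

section NoiseMoments

/-- A bound for `|log P_out|` at a response with label noise `z`. -/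
def logNoiseBound (K Δ z : ℝ) : ℝ :=
  |Real.log (1 / √(2 * Real.pi * Δ))| + (2 * K + √Δ * |z|) ^ 2 / (2 * Δ)

/-- A bound for the sensitivity of the log-partition function to a field whose response has label
noise `z`. -/
def sensNoiseBound (K Δ z : ℝ) : ℝ := (2 * K + √Δ * |z|) / Δ * K

theorem memLp_abs_gaussianReal : MemLp (fun z : ℝ => |z|) 2 (gaussianReal 0 1) :=
  (memLp_id_gaussianReal' (μ := 0) (v := 1) 2 (by norm_num)).abs

theorem memLp_sq_gaussianReal : MemLp (fun z : ℝ => z ^ 2) 2 (gaussianReal 0 1) := by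
  refine (memLp_two_iff_integrable_sq (by fun_prop)).2 ?_
  have := (memLp_id_gaussianReal (μ := 0) (v := 1) 4).integrable_norm_pow (p := 4) (by norm_num)
  refine this.congr (Filter.Eventually.of_forall fun z => ?_)
  simp only [id, Real.norm_eq_abs]
  rw [← pow_mul]
  exact (even_two_mul 2).pow_abs z

/-- The bound is quadratic in `|z|`, so its square is controlled by the fourth Gaussian moment. -/
theorem memLp_logNoiseBound (K : ℝ) {Δ : ℝ} (hΔ : 0 < Δ) :
    MemLp (logNoiseBound K Δ) 2 (gaussianReal 0 1) := by
  have e : logNoiseBound K Δ = fun z => (|Real.log (1 / √(2 * Real.pi * Δ))|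
      + (2 * K) ^ 2 / (2 * Δ)) + (4 * K * √Δ / (2 * Δ) * |z| + 1 / 2 * z ^ 2) := by
    funext z
    have h1 : √Δ ^ 2 = Δ := Real.sq_sqrt hΔ.le
    have h2 := sq_abs z
    unfold logNoiseBound
    have h3 : (√Δ * |z|) ^ 2 = Δ * z ^ 2 := by rw [mul_pow, h1, h2]
    field_simp
    linear_combination h3
  have h0 : MemLp (fun _ : ℝ => |Real.log (1 / √(2 * Real.pi * Δ))| + (2 * K) ^ 2 / (2 * Δ)) 2
    (gaussianReal 0 1) := memLp_const _
  rw [e]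
  exact h0.add ((memLp_abs_gaussianReal.const_mul (4 * K * √Δ / (2 * Δ))).add
    (memLp_sq_gaussianReal.const_mul (1 / 2)))

theorem memLp_sensNoiseBound (K Δ : ℝ) :
    MemLp (sensNoiseBound K Δ) 2 (gaussianReal 0 1) := by
  have e : sensNoiseBound K Δ = fun z => 2 * K / Δ * K + √Δ / Δ * K * |z| := by
    funext z; unfold sensNoiseBound; ring
  have h0 : MemLp (fun _ : ℝ => 2 * K / Δ * K) 2 (gaussianReal 0 1) := memLp_const _
  rw [e]
  exact h0.add (memLp_abs_gaussianReal.const_mul (√Δ / Δ * K))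

variable {k : ℕ} (d n : ℕ) (PA : Measure (Fin k → ℝ)) [IsProbabilityMeasure PA]

theorem measurePreserving_noise :
    MeasurePreserving (fun x : Sample d k => x.2.2.2) (sampleLaw d PA) (gaussianReal 0 1) :=
  (measurePreserving_snd (μ := PA) (ν := gaussianReal 0 1)).comp
    ((measurePreserving_snd (μ := gaussVec d) (ν := PA.prod (gaussianReal 0 1))).comp
      (measurePreserving_snd (μ := gaussianReal 0 1)
        (ν := (gaussVec d).prod (PA.prod (gaussianReal 0 1)))))

theorem measurePreserving_input :
    MeasurePreserving (fun x : Sample d k => x.2.1) (sampleLaw d PA) (gaussVec d) :=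
  (measurePreserving_fst (μ := gaussVec d) (ν := PA.prod (gaussianReal 0 1))).comp
    (measurePreserving_snd (μ := gaussianReal 0 1)
      (ν := (gaussVec d).prod (PA.prod (gaussianReal 0 1))))

theorem measurePreserving_samples_noise (μ : Fin n) :
    MeasurePreserving (fun x : Fin n → Sample d k => (x μ).2.2.2) (samplesLaw d n PA)
      (gaussianReal 0 1) :=
  (measurePreserving_noise d PA).comp (measurePreserving_eval (fun _ : Fin n => sampleLaw d PA) μ)

theorem measurePreserving_samples_input (μ : Fin n) :
    MeasurePreserving (fun x : Fin n → Sample d k => (x μ).2.1) (samplesLaw d n PA)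
      (gaussVec d) :=
  (measurePreserving_input d PA).comp (measurePreserving_eval (fun _ : Fin n => sampleLaw d PA) μ)

theorem memLp_samples_input (μ : Fin n) (j : Fin d) :
    MemLp (fun x : Fin n → Sample d k => (x μ).2.1 j) 2 (samplesLaw d n PA) :=
  (memLp_gaussVec_eval j).comp_measurePreserving (measurePreserving_samples_input d n PA μ)

theorem integral_samples_input_mul (μ : Fin n) (i j : Fin d) :
    ∫ x : Fin n → Sample d k, (x μ).2.1 i * (x μ).2.1 j ∂(samplesLaw d n PA)
      = if i = j then 1 else 0 := by
  rw [← integral_gaussVec_eval_mul_eval i j, ← (measurePreserving_samples_input d n PA μ).map_eq,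
    integral_map (measurePreserving_samples_input d n PA μ).aemeasurable (by fun_prop)]

theorem memLp_samples_sensNoiseBound (K Δ : ℝ) (μ : Fin n) :
    MemLp (fun x : Fin n → Sample d k => sensNoiseBound K Δ (x μ).2.2.2) 2 (samplesLaw d n PA) :=
  (memLp_sensNoiseBound K Δ).comp_measurePreserving (measurePreserving_samples_noise d n PA μ)

theorem integral_samples_sensNoiseBound_sq (K Δ : ℝ) (μ : Fin n) :
    ∫ x : Fin n → Sample d k, sensNoiseBound K Δ (x μ).2.2.2 ^ 2 ∂(samplesLaw d n PA)
      = ∫ z, sensNoiseBound K Δ z ^ 2 ∂(gaussianReal 0 1) := by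
  conv_rhs => rw [← (measurePreserving_samples_noise d n PA μ).map_eq]
  rw [integral_map (measurePreserving_samples_noise d n PA μ).aemeasurable
    (by unfold sensNoiseBound; fun_prop)]

theorem memLp_sample_logNoiseBound (K : ℝ) {Δ : ℝ} (hΔ : 0 < Δ) :
    MemLp (fun x : Sample d k => logNoiseBound K Δ x.2.2.2) 2 (sampleLaw d PA) :=
  (memLp_logNoiseBound K hΔ).comp_measurePreserving (measurePreserving_noise d PA)

theorem integral_sample_logNoiseBound_sq (K Δ : ℝ) :
    ∫ x : Sample d k, logNoiseBound K Δ x.2.2.2 ^ 2 ∂(sampleLaw d PA)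
      = ∫ z, logNoiseBound K Δ z ^ 2 ∂(gaussianReal 0 1) := by
  conv_rhs => rw [← (measurePreserving_noise d PA).map_eq]
  rw [integral_map (measurePreserving_noise d PA).aemeasurable
    (by unfold logNoiseBound; fun_prop)]

end NoiseMoments

/-! ### The log-partition function and its variance over the samples -/

section Model

variable {d p n k : ℕ} {PA : Measure (Fin k → ℝ)}
  {f : ℝ → (Fin k → ℝ) → ℝ} {K Δ : ℝ} {φ : ℝ → ℝ}

/-- The fields of the student with parameters `θ` on the inputs `X`. -/
def studentField (φ : ℝ → ℝ) (t : ℝ) (X : Fin n → Fin d → ℝ) (θ : Params d p n) : Fin n → ℝ :=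
  fun μ => interpField φ t θ.1 θ.2.1 θ.2.2.1 (θ.2.2.2 μ) (X μ)

/-- The teacher's field on one sample. -/
def teacherField (φ : ℝ → ℝ) (t : ℝ) (a : Fin p → ℝ)
    (w : (Fin p → Fin d → ℝ) × (Fin d → ℝ)) (x : Sample d k) : ℝ :=
  interpField φ t a w.1 w.2 x.1 x.2.1

/-- The teacher's responses on the samples. -/
def teacherResponse (f : ℝ → (Fin k → ℝ) → ℝ) (Δ : ℝ) (φ : ℝ → ℝ) (t : ℝ) (a : Fin p → ℝ)
    (w : (Fin p → Fin d → ℝ) × (Fin d → ℝ)) (x : Fin n → Sample d k) : Fin n → ℝ :=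
  fun μ => f (teacherField φ t a w (x μ)) (x μ).2.2.1 + √Δ * (x μ).2.2.2

/-- The log-partition function, in terms of the inner weights and the samples. -/
def logPartition (PA : Measure (Fin k → ℝ)) (f : ℝ → (Fin k → ℝ) → ℝ) (Δ : ℝ) (φ : ℝ → ℝ) (t : ℝ)
    (a : Fin p → ℝ) (w : (Fin p → Fin d → ℝ) × (Fin d → ℝ)) (x : Fin n → Sample d k) : ℝ :=
  Real.log (∫ θ, Real.exp (logLik PA f Δ (teacherResponse f Δ φ t a w x)
    (studentField φ t (fun μ => (x μ).2.1) θ)) ∂(prior d p n))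

theorem freeEntropy_toDisorder (t : ℝ) (a : Fin p → ℝ)
    (q : ((Fin p → Fin d → ℝ) × (Fin d → ℝ)) × (Fin n → Sample d k)) :
    freeEntropy PA f Δ φ t a (toDisorder q) = 1 / (n : ℝ) * logPartition PA f Δ φ t a q.1 q.2 := rfl

variable [IsProbabilityMeasure PA]

theorem measurable_interpField (hφ : Measurable φ) (t : ℝ) :
    Measurable fun q : (Fin p → ℝ) × (Fin p → Fin d → ℝ) × (Fin d → ℝ) × ℝ × (Fin d → ℝ) =>
      interpField φ t q.1 q.2.1 q.2.2.1 q.2.2.2.1 q.2.2.2.2 := by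
  unfold interpField
  fun_prop

theorem measurable_studentField (hφ : Measurable φ) (t : ℝ) :
    Measurable fun q : (Fin n → Fin d → ℝ) × Params d p n => studentField φ t q.1 q.2 := by
  refine measurable_pi_lambda _ fun μ => ?_
  exact (measurable_interpField hφ t).comp (f := fun q : (Fin n → Fin d → ℝ) × Params d p n =>
    (q.2.1, q.2.2.1, q.2.2.2.1, q.2.2.2.2 μ, q.1 μ)) (by fun_prop)

theorem measurable_studentField_apply (hφ : Measurable φ) (t : ℝ) (X : Fin n → Fin d → ℝ) :
    Measurable (studentField (p := p) φ t X) :=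
  (measurable_studentField (d := d) (p := p) (n := n) hφ t).comp
    (f := fun θ : Params d p n => (X, θ)) (by fun_prop)

theorem measurable_teacherField (hφ : Measurable φ) (t : ℝ) :
    Measurable fun q : (Fin p → ℝ) × ((Fin p → Fin d → ℝ) × (Fin d → ℝ)) × Sample d k =>
      teacherField φ t q.1 q.2.1 q.2.2 :=
  (measurable_interpField hφ t).comp
    (f := fun q : (Fin p → ℝ) × ((Fin p → Fin d → ℝ) × (Fin d → ℝ)) × Sample d k =>
      (q.1, q.2.1.1, q.2.1.2, q.2.2.1, q.2.2.2.1)) (by fun_prop)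

theorem ReadoutBound.measurable_teacherResponse (hf : ReadoutBound f K) (Δ : ℝ) (hφ : Measurable φ)
    (t : ℝ) :
    Measurable fun q : (Fin p → ℝ) × ((Fin p → Fin d → ℝ) × (Fin d → ℝ)) × (Fin n → Sample d k) =>
      teacherResponse f Δ φ t q.1 q.2.1 q.2.2 := by
  refine measurable_pi_lambda _ fun μ => ?_
  have h1 : Measurable fun q : (Fin p → ℝ) × ((Fin p → Fin d → ℝ) × (Fin d → ℝ)) ×
      (Fin n → Sample d k) => teacherField φ t q.1 q.2.1 (q.2.2 μ) :=
    (measurable_teacherField hφ t).comp (f := fun q : (Fin p → ℝ) ×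
      ((Fin p → Fin d → ℝ) × (Fin d → ℝ)) × (Fin n → Sample d k) => (q.1, q.2.1, q.2.2 μ))
      (by fun_prop)
  have h2 := hf.measurable.comp (f := fun q : (Fin p → ℝ) ×
      ((Fin p → Fin d → ℝ) × (Fin d → ℝ)) × (Fin n → Sample d k) =>
      (teacherField φ t q.1 q.2.1 (q.2.2 μ), (q.2.2 μ).2.2.1)) (h1.prodMk (by fun_prop))
  have h3 : Measurable fun q : (Fin p → ℝ) × ((Fin p → Fin d → ℝ) × (Fin d → ℝ)) ×
      (Fin n → Sample d k) => √Δ * (q.2.2 μ).2.2.2 := by fun_prop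
  exact h2.add h3

theorem ReadoutBound.measurable_lik (hf : ReadoutBound f K) (Δ : ℝ) (hφ : Measurable φ) (t : ℝ) :
    Measurable fun r : ((Fin n → Fin d → ℝ) × (Fin n → ℝ)) × Params d p n =>
      Real.exp (logLik PA f Δ r.1.2 (studentField φ t r.1.1 r.2)) := by
  refine Real.measurable_exp.comp ((hf.measurable_logLik Δ).comp
    (f := fun r : ((Fin n → Fin d → ℝ) × (Fin n → ℝ)) × Params d p n =>
      (r.1.2, studentField φ t r.1.1 r.2)) ?_)
  have h : Measurable fun r : ((Fin n → Fin d → ℝ) × (Fin n → ℝ)) × Params d p n =>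
      studentField φ t r.1.1 r.2 :=
    (measurable_studentField (d := d) (p := p) (n := n) hφ t).comp
      (f := fun r : ((Fin n → Fin d → ℝ) × (Fin n → ℝ)) × Params d p n => (r.1.1, r.2))
      (by fun_prop)
  exact measurable_fst.snd.prodMk h

theorem ReadoutBound.measurable_logPartition (hf : ReadoutBound f K) (Δ : ℝ) (hφ : Measurable φ)
    (t : ℝ) :
    Measurable fun q : (Fin p → ℝ) × ((Fin p → Fin d → ℝ) × (Fin d → ℝ)) × (Fin n → Sample d k) =>
      logPartition PA f Δ φ t q.1 q.2.1 q.2.2 := by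
  have h := (hf.measurable_lik (PA := PA) (d := d) (p := p) (n := n)
    Δ hφ t).stronglyMeasurable.integral_prod_right' (ν := prior d p n)
  refine Real.measurable_log.comp (h.measurable.comp (f := fun q : (Fin p → ℝ) ×
      ((Fin p → Fin d → ℝ) × (Fin d → ℝ)) × (Fin n → Sample d k) =>
      ((fun μ => (q.2.2 μ).2.1), teacherResponse f Δ φ t q.1 q.2.1 q.2.2)) ?_)
  exact Measurable.prodMk (by fun_prop) (hf.measurable_teacherResponse Δ hφ t)

/-- This is the source of the `2 * K` in the noise bounds: one `K` for the teacher's readout, one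
for the readout inside `P_out`. -/
theorem ReadoutBound.abs_teacherResponse_add_le (hf : ReadoutBound f K) (Δ t : ℝ) (a : Fin p → ℝ)
    (w : (Fin p → Fin d → ℝ) × (Fin d → ℝ)) (x : Fin n → Sample d k) (μ : Fin n) :
    |teacherResponse f Δ φ t a w x μ| + K ≤ 2 * K + √Δ * |(x μ).2.2.2| := by
  unfold teacherResponse
  have h1 := abs_add_le (f (teacherField φ t a w (x μ)) (x μ).2.2.1) (√Δ * (x μ).2.2.2)
  have h2 := hf.bdd (teacherField φ t a w (x μ)) (x μ).2.2.1
  rw [abs_mul, abs_of_nonneg (Real.sqrt_nonneg Δ)] at h1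
  linarith

theorem ReadoutBound.abs_logPout_response_le (hf : ReadoutBound f K) (hΔ : 0 < Δ) (t : ℝ)
    (a : Fin p → ℝ) (w : (Fin p → Fin d → ℝ) × (Fin d → ℝ)) (x : Fin n → Sample d k) (μ : Fin n)
    (s : ℝ) : |logPout PA f Δ (teacherResponse f Δ φ t a w x μ) s|
      ≤ logNoiseBound K Δ (x μ).2.2.2 := by
  refine (hf.abs_logPout_le hΔ _ s).trans ?_
  unfold logNoiseBound
  have h := hf.abs_teacherResponse_add_le (φ := φ) Δ t a w x μ
  have hK := hf.nonneg
  gcongr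

/-- Comparison with the exponent `0`. The bound involves neither `a` nor `w`, so it yields square
integrability over the whole disorder. -/
theorem ReadoutBound.abs_logPartition_le (hf : ReadoutBound f K) (hΔ : 0 < Δ) (hφ : Measurable φ)
    (t : ℝ) (a : Fin p → ℝ) (w : (Fin p → Fin d → ℝ) × (Fin d → ℝ)) (x : Fin n → Sample d k) :
    |logPartition PA f Δ φ t a w x| ≤ ∑ μ, logNoiseBound K Δ (x μ).2.2.2 := by
  have hs : Measurable (studentField (p := p) φ t fun μ => (x μ).2.1) :=
    measurable_studentField_apply hφ t _
  have h := abs_log_integral_exp_sub_le (π := prior d p n) (v := fun _ => 0)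
    (hf.integrable_exp_logLik (PA := PA) hΔ (teacherResponse f Δ φ t a w x) hs)
    (by simp) (c := ∑ μ, logNoiseBound K Δ (x μ).2.2.2) (fun θ => by
      rw [sub_zero]
      exact (Finset.abs_sum_le_sum_abs _ _).trans (Finset.sum_le_sum fun μ _ =>
        hf.abs_logPout_response_le hΔ t a w x μ _))
  simpa [logPartition] using h

theorem ReadoutBound.abs_logPartition_update_sub_le (hf : ReadoutBound f K) (hΔ : 0 < Δ)
    (hφ : Measurable φ) (t : ℝ) (a : Fin p → ℝ) (w : (Fin p → Fin d → ℝ) × (Fin d → ℝ))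
    (x : Fin n → Sample d k) (μ : Fin n) (y : Sample d k) :
    |logPartition PA f Δ φ t a w (Function.update x μ y) - logPartition PA f Δ φ t a w x|
      ≤ logNoiseBound K Δ y.2.2.2 + logNoiseBound K Δ (x μ).2.2.2 := by
  have hs : ∀ x : Fin n → Sample d k,
      Measurable (studentField (p := p) φ t fun μ => (x μ).2.1) :=
    fun x => measurable_studentField_apply hφ t _
  refine abs_log_integral_exp_sub_le (π := prior d p n)
    (hf.integrable_exp_logLik (PA := PA) hΔ _ (hs _))
    (hf.integrable_exp_logLik (PA := PA) hΔ _ (hs _)) fun θ => ?_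
  unfold logLik
  -- At fixed `θ`, the `ν`-th response and the `ν`-th student field see only the sample `ν`, so only
  -- the `μ`-th summand changes.
  rw [← Finset.sum_sub_distrib, Finset.sum_eq_single μ]
  · have h1 := hf.abs_logPout_response_le (PA := PA) (φ := φ) hΔ t a w (Function.update x μ y) μ
      (studentField φ t (fun μ' => (Function.update x μ y μ').2.1) θ μ)
    have h2 := hf.abs_logPout_response_le (PA := PA) (φ := φ) hΔ t a w x μ
      (studentField φ t (fun μ' => (x μ').2.1) θ μ)
    rw [Function.update_self] at h1
    exact (abs_sub _ _).trans (add_le_add h1 h2)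
  · intro ν _ hν
    simp [teacherResponse, studentField, Function.update_of_ne hν]
  · simp

theorem ReadoutBound.memLp_and_variance_logPartition_le (hf : ReadoutBound f K) (hΔ : 0 < Δ)
    (hφ : Measurable φ) (t : ℝ) (a : Fin p → ℝ) (w : (Fin p → Fin d → ℝ) × (Fin d → ℝ)) :
    MemLp (fun x => logPartition PA f Δ φ t a w x) 2 (samplesLaw d n PA) ∧
      Var[fun x => logPartition PA f Δ φ t a w x; samplesLaw d n PA]
        ≤ 2 * n * ∫ z, logNoiseBound K Δ z ^ 2 ∂(gaussianReal 0 1) := by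
  have h := memLp_and_variance_pi_le (memLp_sample_logNoiseBound d PA K hΔ) n
    (fun x => logPartition PA f Δ φ t a w x)
    ((hf.measurable_logPartition Δ hφ t).comp
      (f := fun x : Fin n → Sample d k => (a, w, x)) (by fun_prop))
    (fun x i y => hf.abs_logPartition_update_sub_le hΔ hφ t a w x i y)
  rw [integral_sample_logNoiseBound_sq] at h
  exact h

end Model

/-! ### Differentiation in the teacher's inner weights -/

section WeightDerivative

variable {d p n k : ℕ} {PA : Measure (Fin k → ℝ)} [IsProbabilityMeasure PA]
  {f : ℝ → (Fin k → ℝ) → ℝ} {K Δ : ℝ} {φ : ℝ → ℝ}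

/-- The derivative of the teacher's field at the inner weights `w` in the direction `w'`. -/
def dField (φ : ℝ → ℝ) (t : ℝ) (a : Fin p → ℝ) (w w' : (Fin p → Fin d → ℝ) × (Fin d → ℝ))
    (X : Fin d → ℝ) : ℝ :=
  √(1 - t) * ((∑ i, a i * (deriv φ ((∑ j, w.1 i j * X j) / √d) *
      ((∑ j, w'.1 i j * X j) / √d))) / √p)
    + √t * rho φ * ((∑ j, w'.2 j * X j) / √d)

theorem hasDerivAt_interpField (hφ : Differentiable ℝ φ) (t : ℝ) (a : Fin p → ℝ) (ξ : ℝ)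
    (X : Fin d → ℝ) {w : ℝ → (Fin p → Fin d → ℝ) × (Fin d → ℝ)}
    {w' : (Fin p → Fin d → ℝ) × (Fin d → ℝ)} {θ : ℝ} (hw : HasDerivAt w w' θ) :
    HasDerivAt (fun θ => interpField φ t a (w θ).1 (w θ).2 ξ X) (dField φ t a (w θ) w' X) θ := by
  have h1 : ∀ i j, HasDerivAt (fun θ => (w θ).1 i j) (w'.1 i j) θ := fun i j =>
    hasDerivAt_pi.1 (hasDerivAt_pi.1 hw.fst i) j
  have h2 : ∀ j, HasDerivAt (fun θ => (w θ).2 j) (w'.2 j) θ := fun j => hasDerivAt_pi.1 hw.snd j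
  have h3 : ∀ i, HasDerivAt (fun θ => (∑ j, (w θ).1 i j * X j) / √d)
      ((∑ j, w'.1 i j * X j) / √d) θ := fun i =>
    (HasDerivAt.fun_sum fun j _ => (h1 i j).mul_const (X j)).div_const _
  have h4 : HasDerivAt (fun θ => (∑ j, (w θ).2 j * X j) / √d) ((∑ j, w'.2 j * X j) / √d) θ :=
    (HasDerivAt.fun_sum fun j _ => (h2 j).mul_const (X j)).div_const _
  have h5 : ∀ i, HasDerivAt (fun θ => φ ((∑ j, (w θ).1 i j * X j) / √d))
      (deriv φ ((∑ j, (w θ).1 i j * X j) / √d) * ((∑ j, w'.1 i j * X j) / √d)) θ := fun i =>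
    (hφ _).hasDerivAt.comp θ (h3 i)
  have h6 := ((HasDerivAt.fun_sum fun i (_ : i ∈ Finset.univ) =>
    (h5 i).const_mul (a i)).div_const √p).const_mul √(1 - t)
  exact (h6.add (h4.const_mul (√t * rho φ))).add_const _

/-- Along the rotation path the rotated pair consists of a position and its velocity, so a
directional derivative along the path is a function of the rotated pair alone. -/
theorem hasDerivAt_rotation_fst {E : Type*} [NormedAddCommGroup E] [NormedSpace ℝ E] (z : E × E)
    (θ : ℝ) : HasDerivAt (fun θ => (ContinuousLinearMap.rotation θ z).1)
      (ContinuousLinearMap.rotation θ z).2 θ := by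
  simp only [ContinuousLinearMap.rotation_apply]
  exact ((Real.hasDerivAt_cos θ).smul_const z.1).add ((Real.hasDerivAt_sin θ).smul_const z.2)

theorem norm_rotation_snd_le {E : Type*} [NormedAddCommGroup E] [NormedSpace ℝ E] (z : E × E)
    (θ : ℝ) : ‖(ContinuousLinearMap.rotation θ z).2‖ ≤ ‖z.1‖ + ‖z.2‖ := by
  simp only [ContinuousLinearMap.rotation_apply]
  refine (norm_add_le _ _).trans (add_le_add ?_ ?_)
  · rw [norm_smul, norm_neg]
    exact mul_le_of_le_one_left (norm_nonneg _) (Real.abs_sin_le_one θ)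
  · rw [norm_smul]
    exact mul_le_of_le_one_left (norm_nonneg _) (Real.abs_cos_le_one θ)

theorem abs_sum_mul_div_sqrt_le (hd : 0 < d) {u X : Fin d → ℝ} {B : ℝ} (hu : ∀ j, |u j| ≤ B) :
    |(∑ j, u j * X j) / √d| ≤ B * ∑ j, |X j| := by
  have h1 : (1 : ℝ) ≤ √d := Real.one_le_sqrt.2 (by exact_mod_cast hd)
  rw [abs_div, abs_of_nonneg (Real.sqrt_nonneg _)]
  refine (div_le_self (abs_nonneg _) h1).trans ((Finset.abs_sum_le_sum_abs _ _).trans ?_)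
  rw [Finset.mul_sum]
  refine Finset.sum_le_sum fun j _ => ?_
  rw [abs_mul]
  exact mul_le_mul_of_nonneg_right (hu j) (abs_nonneg _)

/-- A crude bound that discards `1/√d` and `1/√p`. It serves only for domination and integrability;
its constants do not enter the final estimate. -/
theorem abs_dField_le (hd : 0 < d) (hp : 0 < p) {L : ℝ} (hL : ∀ x, |deriv φ x| ≤ L) {t : ℝ}
    (ht : t ∈ Set.Icc (0 : ℝ) 1) (a : Fin p → ℝ) (w w' : (Fin p → Fin d → ℝ) × (Fin d → ℝ))
    (X : Fin d → ℝ) :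
    |dField φ t a w w' X| ≤ ((∑ i, |a i|) * L + |rho φ|) * (‖w'‖ * ∑ j, |X j|) := by
  have hp1 : (1 : ℝ) ≤ √p := Real.one_le_sqrt.2 (by exact_mod_cast hp)
  have ht1 : √(1 - t) ≤ 1 := Real.sqrt_le_one.2 (by linarith [ht.1])
  have ht2 : √t ≤ 1 := Real.sqrt_le_one.2 ht.2
  have hL0 : 0 ≤ L := (abs_nonneg _).trans (hL 0)
  have hX : 0 ≤ ‖w'‖ * ∑ j, |X j| := mul_nonneg (norm_nonneg _)
    (Finset.sum_nonneg fun j _ => abs_nonneg _)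
  have hW : ∀ i j, |w'.1 i j| ≤ ‖w'‖ := fun i j =>
    ((norm_le_pi_norm (w'.1 i) j).trans (norm_le_pi_norm w'.1 i)).trans (norm_fst_le w')
  have hv : ∀ j, |w'.2 j| ≤ ‖w'‖ := fun j => (norm_le_pi_norm w'.2 j).trans (norm_snd_le w')
  unfold dField
  rw [add_mul]
  refine (abs_add_le _ _).trans (add_le_add ?_ ?_)
  · rw [abs_mul, abs_of_nonneg (Real.sqrt_nonneg _), abs_div, abs_of_nonneg (Real.sqrt_nonneg _)]
    refine (mul_le_of_le_one_left (by positivity) ht1).trans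
      ((div_le_self (abs_nonneg _) hp1).trans ((Finset.abs_sum_le_sum_abs _ _).trans ?_))
    rw [Finset.sum_mul, Finset.sum_mul]
    refine Finset.sum_le_sum fun i _ => ?_
    rw [abs_mul, abs_mul, mul_assoc]
    exact mul_le_mul_of_nonneg_left (mul_le_mul (hL _) (abs_sum_mul_div_sqrt_le hd (hW i))
      (abs_nonneg _) hL0) (abs_nonneg _)
  · rw [abs_mul, abs_mul, abs_of_nonneg (Real.sqrt_nonneg _)]
    exact mul_le_mul (mul_le_of_le_one_left (abs_nonneg _) ht2) (abs_sum_mul_div_sqrt_le hd hv)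
      (abs_nonneg _) (abs_nonneg _)

/-- The derivative of the log-partition function with respect to the `μ`-th field of the
teacher. -/
def sensitivity (PA : Measure (Fin k → ℝ)) (f : ℝ → (Fin k → ℝ) → ℝ) (Δ : ℝ) (φ : ℝ → ℝ) (t : ℝ)
    (a : Fin p → ℝ) (w : (Fin p → Fin d → ℝ) × (Fin d → ℝ)) (x : Fin n → Sample d k)
    (μ : Fin n) : ℝ :=
  meanScore (prior d p n) PA f Δ (studentField φ t fun μ => (x μ).2.1)
      (teacherResponse f Δ φ t a w x) μ *
    deriv (fun s => f s (x μ).2.2.1) (teacherField φ t a w (x μ))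

theorem ReadoutBound.abs_sensitivity_le (hf : ReadoutBound f K) (hΔ : 0 < Δ) (hφ : Measurable φ)
    (t : ℝ) (a : Fin p → ℝ) (w : (Fin p → Fin d → ℝ) × (Fin d → ℝ)) (x : Fin n → Sample d k)
    (μ : Fin n) : |sensitivity PA f Δ φ t a w x μ| ≤ sensNoiseBound K Δ (x μ).2.2.2 := by
  unfold sensitivity sensNoiseBound
  have hK := hf.nonneg
  rw [abs_mul]
  refine mul_le_mul ((hf.abs_meanScore_le hΔ _ (measurable_studentField_apply hφ t _) μ).trans ?_)
    (hf.bdd_deriv _ _) (abs_nonneg _) (by positivity)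
  exact div_le_div_of_nonneg_right (hf.abs_teacherResponse_add_le Δ t a w x μ) hΔ.le

theorem ReadoutBound.measurable_sensitivity (hf : ReadoutBound f K) (Δ : ℝ) (hφ : Measurable φ)
    (t : ℝ) (a : Fin p → ℝ) (μ : Fin n) :
    Measurable fun q : ((Fin p → Fin d → ℝ) × (Fin d → ℝ)) × (Fin n → Sample d k) =>
      sensitivity PA f Δ φ t a q.1 q.2 μ := by
  have hlik := hf.measurable_lik (PA := PA) (d := d) (p := p) (n := n) Δ hφ t
  have hs : Measurable fun r : ((Fin n → Fin d → ℝ) × (Fin n → ℝ)) × Params d p n =>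
      studentField φ t r.1.1 r.2 :=
    (measurable_studentField (d := d) (p := p) (n := n) hφ t).comp
      (f := fun r : ((Fin n → Fin d → ℝ) × (Fin n → ℝ)) × Params d p n => (r.1.1, r.2))
      (by fun_prop)
  have hscore : Measurable fun r : ((Fin n → Fin d → ℝ) × (Fin n → ℝ)) × Params d p n =>
      score PA f Δ (r.1.2 μ) (studentField φ t r.1.1 r.2 μ) :=
    (hf.measurable_score Δ).comp
      (f := fun r : ((Fin n → Fin d → ℝ) × (Fin n → ℝ)) × Params d p n =>
        (r.1.2 μ, studentField φ t r.1.1 r.2 μ))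
      (Measurable.prodMk (by fun_prop) ((measurable_pi_apply μ).comp hs))
  have hms : Measurable fun r : (Fin n → Fin d → ℝ) × (Fin n → ℝ) =>
      meanScore (prior d p n) PA f Δ (studentField φ t r.1) r.2 μ :=
    ((hlik.mul hscore).stronglyMeasurable.integral_prod_right' (ν := prior d p n)).measurable.div
      (hlik.stronglyMeasurable.integral_prod_right' (ν := prior d p n)).measurable
  have hr : Measurable fun q : ((Fin p → Fin d → ℝ) × (Fin d → ℝ)) × (Fin n → Sample d k) =>
      teacherResponse f Δ φ t a q.1 q.2 :=
    (hf.measurable_teacherResponse Δ hφ t).comp (f := fun q : ((Fin p → Fin d → ℝ) ×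
      (Fin d → ℝ)) × (Fin n → Sample d k) => (a, q.1, q.2)) (by fun_prop)
  have ht : Measurable fun q : ((Fin p → Fin d → ℝ) × (Fin d → ℝ)) × (Fin n → Sample d k) =>
      teacherField φ t a q.1 (q.2 μ) :=
    (measurable_teacherField hφ t).comp (f := fun q : ((Fin p → Fin d → ℝ) ×
      (Fin d → ℝ)) × (Fin n → Sample d k) => (a, q.1, q.2 μ)) (by fun_prop)
  have h1 : Measurable fun q : ((Fin p → Fin d → ℝ) × (Fin d → ℝ)) × (Fin n → Sample d k) =>
      meanScore (prior d p n) PA f Δ (studentField φ t fun μ => (q.2 μ).2.1)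
        (teacherResponse f Δ φ t a q.1 q.2) μ :=
    hms.comp (f := fun q : ((Fin p → Fin d → ℝ) × (Fin d → ℝ)) × (Fin n → Sample d k) =>
      ((fun μ => (q.2 μ).2.1), teacherResponse f Δ φ t a q.1 q.2))
      (Measurable.prodMk (by fun_prop) hr)
  have h2 : Measurable fun q : ((Fin p → Fin d → ℝ) × (Fin d → ℝ)) × (Fin n → Sample d k) =>
      deriv (fun s => f s (q.2 μ).2.2.1) (teacherField φ t a q.1 (q.2 μ)) :=
    hf.measurable_deriv.comp (f := fun q : ((Fin p → Fin d → ℝ) × (Fin d → ℝ)) ×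
      (Fin n → Sample d k) => (teacherField φ t a q.1 (q.2 μ), (q.2 μ).2.2.1))
      (ht.prodMk (by fun_prop))
  exact h1.mul h2

/-- Chain rule through the responses only: the student's fields depend on the inputs but not on the
teacher's weights. -/
theorem ReadoutBound.hasDerivAt_logPartition (hf : ReadoutBound f K) (hΔ : 0 < Δ)
    (hφ : Differentiable ℝ φ) (t : ℝ) (a : Fin p → ℝ) (x : Fin n → Sample d k)
    {w : ℝ → (Fin p → Fin d → ℝ) × (Fin d → ℝ)}
    {w' : (Fin p → Fin d → ℝ) × (Fin d → ℝ)} {θ : ℝ} (hw : HasDerivAt w w' θ) :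
    HasDerivAt (fun θ => logPartition PA f Δ φ t a (w θ) x)
      (∑ μ, sensitivity PA f Δ φ t a (w θ) x μ * dField φ t a (w θ) w' (x μ).2.1) θ := by
  have h1 : HasDerivAt (fun θ => teacherResponse f Δ φ t a (w θ) x)
      (fun μ => deriv (fun s => f s (x μ).2.2.1) (teacherField φ t a (w θ) (x μ)) *
        dField φ t a (w θ) w' (x μ).2.1) θ := by
    refine hasDerivAt_pi.2 fun μ => ?_
    have h2 := (hf.differentiable (x μ).2.2.1 (teacherField φ t a (w θ) (x μ))).hasDerivAt
    have h3 := hasDerivAt_interpField hφ t a (x μ).1 (x μ).2.1 hw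
    exact (HasDerivAt.comp (h₂ := fun s => f s (x μ).2.2.1)
      (h := fun θ => teacherField φ t a (w θ) (x μ)) θ h2 h3).add_const _
  have h4 := hf.hasFDerivAt_log_integral (PA := PA) (π := prior d p n) hΔ
    (teacherResponse f Δ φ t a (w θ) x)
    (measurable_studentField_apply hφ.continuous.measurable t fun μ => (x μ).2.1)
  refine (h4.comp_hasDerivAt θ h1).congr_deriv ?_
  rw [sum_apply]
  refine Finset.sum_congr rfl fun μ _ => ?_
  simp only [smul_apply, ContinuousLinearMap.proj_apply, smul_eq_mul]
  unfold sensitivity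
  ring

end WeightDerivative

/-! ### The sample-averaged log-partition function and its derivative -/

section WeightVariance

variable {d p n k : ℕ} {PA : Measure (Fin k → ℝ)} [IsProbabilityMeasure PA]
  {f : ℝ → (Fin k → ℝ) → ℝ} {K Δ L t : ℝ} {φ : ℝ → ℝ}

/-- The log-partition function averaged over the samples. -/
def meanLogPartition (n : ℕ) (PA : Measure (Fin k → ℝ)) (f : ℝ → (Fin k → ℝ) → ℝ) (Δ : ℝ)
    (φ : ℝ → ℝ) (t : ℝ) (a : Fin p → ℝ) (w : (Fin p → Fin d → ℝ) × (Fin d → ℝ)) : ℝ :=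
  ∫ x, logPartition PA f Δ φ t a w x ∂(samplesLaw d n PA)

/-- The derivative of `meanLogPartition` at `z.1` in the direction `z.2`. -/
def dMeanLogPartition (n : ℕ) (PA : Measure (Fin k → ℝ)) (f : ℝ → (Fin k → ℝ) → ℝ) (Δ : ℝ)
    (φ : ℝ → ℝ) (t : ℝ) (a : Fin p → ℝ)
    (z : ((Fin p → Fin d → ℝ) × (Fin d → ℝ)) × ((Fin p → Fin d → ℝ) × (Fin d → ℝ))) : ℝ :=
  ∫ x : Fin n → Sample d k, ∑ μ, sensitivity PA f Δ φ t a z.1 x μ *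
    dField φ t a z.1 z.2 (x μ).2.1 ∂(samplesLaw d n PA)

theorem measurable_dField (φ : ℝ → ℝ) (t : ℝ) (a : Fin p → ℝ) :
    Measurable fun q : (((Fin p → Fin d → ℝ) × (Fin d → ℝ)) ×
      ((Fin p → Fin d → ℝ) × (Fin d → ℝ))) × (Fin d → ℝ) => dField φ t a q.1.1 q.1.2 q.2 := by
  unfold dField
  fun_prop

theorem ReadoutBound.measurable_weightIntegrand (hf : ReadoutBound f K) (Δ : ℝ)
    (hφ : Measurable φ) (t : ℝ) (a : Fin p → ℝ) :
    Measurable fun q : (((Fin p → Fin d → ℝ) × (Fin d → ℝ)) ×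
      ((Fin p → Fin d → ℝ) × (Fin d → ℝ))) × (Fin n → Sample d k) =>
      ∑ μ, sensitivity PA f Δ φ t a q.1.1 q.2 μ * dField φ t a q.1.1 q.1.2 (q.2 μ).2.1 := by
  refine Finset.measurable_fun_sum _ fun μ _ => Measurable.mul ?_ ?_
  · exact (hf.measurable_sensitivity Δ hφ t a μ).comp (f := fun q : (((Fin p → Fin d → ℝ) ×
      (Fin d → ℝ)) × ((Fin p → Fin d → ℝ) × (Fin d → ℝ))) × (Fin n → Sample d k) => (q.1.1, q.2))
      (by fun_prop)
  · exact (measurable_dField φ t a).comp (f := fun q : (((Fin p → Fin d → ℝ) ×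
      (Fin d → ℝ)) × ((Fin p → Fin d → ℝ) × (Fin d → ℝ))) × (Fin n → Sample d k) =>
      (q.1, (q.2 μ).2.1)) (by fun_prop)

/-- A bound for the directional derivative of the log-partition function. -/
def weightBound (K Δ : ℝ) (x : Fin n → Sample d k) : ℝ :=
  ∑ μ, sensNoiseBound K Δ (x μ).2.2.2 * ∑ j, |(x μ).2.1 j|

theorem integrable_weightBound (K Δ : ℝ) :
    Integrable (weightBound (d := d) (n := n) K Δ) (samplesLaw d n PA) := by
  refine integrable_finsetSum _ fun μ _ => ?_
  have h1 := memLp_samples_sensNoiseBound d n PA K Δ μ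
  have h2 : MemLp (fun x : Fin n → Sample d k => ∑ j, |(x μ).2.1 j|) 2 (samplesLaw d n PA) :=
    memLp_finsetSum _ fun j _ => (memLp_samples_input d n PA μ j).abs
  exact h1.integrable_mul h2

theorem ReadoutBound.abs_weightIntegrand_le (hf : ReadoutBound f K) (hΔ : 0 < Δ)
    (hφ : Measurable φ) (hd : 0 < d) (hp : 0 < p) (hL : ∀ x, |deriv φ x| ≤ L)
    (ht : t ∈ Set.Icc (0 : ℝ) 1) (a : Fin p → ℝ) (w w' : (Fin p → Fin d → ℝ) × (Fin d → ℝ))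
    (x : Fin n → Sample d k) :
    |∑ μ, sensitivity PA f Δ φ t a w x μ * dField φ t a w w' (x μ).2.1|
      ≤ ((∑ i, |a i|) * L + |rho φ|) * ‖w'‖ * weightBound K Δ x := by
  unfold weightBound
  refine (Finset.abs_sum_le_sum_abs _ _).trans ?_
  rw [Finset.mul_sum]
  refine Finset.sum_le_sum fun μ _ => ?_
  have h1 := hf.abs_sensitivity_le (PA := PA) hΔ hφ t a w x μ
  have h2 := abs_dField_le hd hp hL ht a w w' (x μ).2.1
  rw [abs_mul]
  refine (mul_le_mul h1 h2 (abs_nonneg _) ((abs_nonneg _).trans h1)).trans (le_of_eq ?_)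
  ring

theorem ReadoutBound.integrable_weightIntegrand (hf : ReadoutBound f K) (hΔ : 0 < Δ)
    (hφ : Measurable φ) (hd : 0 < d) (hp : 0 < p) (hL : ∀ x, |deriv φ x| ≤ L)
    (ht : t ∈ Set.Icc (0 : ℝ) 1) (a : Fin p → ℝ) (w w' : (Fin p → Fin d → ℝ) × (Fin d → ℝ)) :
    Integrable (fun x : Fin n → Sample d k => ∑ μ, sensitivity PA f Δ φ t a w x μ *
      dField φ t a w w' (x μ).2.1) (samplesLaw d n PA) := by
  refine ((integrable_weightBound K Δ).const_mul
    (((∑ i, |a i|) * L + |rho φ|) * ‖w'‖)).mono' ?_ (Filter.Eventually.of_forall fun x =>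
      hf.abs_weightIntegrand_le hΔ hφ hd hp hL ht a w w' x)
  exact ((hf.measurable_weightIntegrand Δ hφ t a).comp
    (f := fun x : Fin n → Sample d k => ((w, w'), x)) (by fun_prop)).aestronglyMeasurable

theorem ReadoutBound.abs_dMeanLogPartition_le (hf : ReadoutBound f K) (hΔ : 0 < Δ)
    (hφ : Measurable φ) (hd : 0 < d) (hp : 0 < p) (hL : ∀ x, |deriv φ x| ≤ L)
    (ht : t ∈ Set.Icc (0 : ℝ) 1) (a : Fin p → ℝ)
    (z : ((Fin p → Fin d → ℝ) × (Fin d → ℝ)) × ((Fin p → Fin d → ℝ) × (Fin d → ℝ))) :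
    |dMeanLogPartition n PA f Δ φ t a z| ≤ ((∑ i, |a i|) * L + |rho φ|) * ‖z.2‖ *
      ∫ x : Fin n → Sample d k, weightBound K Δ x ∂(samplesLaw d n PA) := by
  unfold dMeanLogPartition
  rw [← integral_const_mul, ← Real.norm_eq_abs]
  exact norm_integral_le_of_norm_le ((integrable_weightBound K Δ).const_mul _)
    (Filter.Eventually.of_forall fun x => hf.abs_weightIntegrand_le hΔ hφ hd hp hL ht a z.1 z.2 x)

theorem ReadoutBound.measurable_dMeanLogPartition (hf : ReadoutBound f K) (Δ : ℝ)
    (hφ : Measurable φ) (t : ℝ) (a : Fin p → ℝ) :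
    Measurable (dMeanLogPartition (d := d) n PA f Δ φ t a) :=
  ((hf.measurable_weightIntegrand (PA := PA) (n := n) (d := d) Δ hφ t
    a).stronglyMeasurable.integral_prod_right' (ν := samplesLaw d n PA)).measurable

theorem ReadoutBound.hasDerivAt_meanLogPartition (hf : ReadoutBound f K) (hΔ : 0 < Δ)
    (hφ : Differentiable ℝ φ) (hd : 0 < d) (hp : 0 < p) (hL : ∀ x, |deriv φ x| ≤ L)
    (ht : t ∈ Set.Icc (0 : ℝ) 1) (a : Fin p → ℝ)
    (z : ((Fin p → Fin d → ℝ) × (Fin d → ℝ)) × ((Fin p → Fin d → ℝ) × (Fin d → ℝ))) (θ : ℝ) :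
    HasDerivAt (fun θ => meanLogPartition n PA f Δ φ t a (ContinuousLinearMap.rotation θ z).1)
      (dMeanLogPartition n PA f Δ φ t a (ContinuousLinearMap.rotation θ z)) θ := by
  have hφm := hφ.continuous.measurable
  have hmem := fun θ : ℝ => (hf.memLp_and_variance_logPartition_le (PA := PA) (n := n) hΔ hφm t a
    (ContinuousLinearMap.rotation θ z).1).1
  have hL0 : 0 ≤ L := (abs_nonneg _).trans (hL 0)
  have hC : 0 ≤ (∑ i, |a i|) * L + |rho φ| := by positivity
  refine (hasDerivAt_integral_of_dominated_loc_of_deriv_le (𝕜 := ℝ) (μ := samplesLaw d n PA)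
    (s := Set.univ)
    (F := fun θ x => logPartition PA f Δ φ t a (ContinuousLinearMap.rotation θ z).1 x)
    (F' := fun θ x => ∑ μ, sensitivity PA f Δ φ t a (ContinuousLinearMap.rotation θ z).1 x μ *
      dField φ t a (ContinuousLinearMap.rotation θ z).1 (ContinuousLinearMap.rotation θ z).2
        (x μ).2.1)
    -- The velocity has norm at most `‖z.1‖ + ‖z.2‖` at every angle, so the domination holds on the
    -- whole line.
    (bound := fun x => ((∑ i, |a i|) * L + |rho φ|) * (‖z.1‖ + ‖z.2‖) * weightBound K Δ x)
    Filter.univ_mem (Filter.Eventually.of_forall fun θ => (hmem θ).aestronglyMeasurable)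
    ((hmem θ).integrable (by norm_num))
    (hf.integrable_weightIntegrand hΔ hφm hd hp hL ht a _ _).aestronglyMeasurable
    (Filter.Eventually.of_forall fun x θ _ => ?_) ((integrable_weightBound K Δ).const_mul _)
    (Filter.Eventually.of_forall fun x θ _ =>
      hf.hasDerivAt_logPartition hΔ hφ t a x (hasDerivAt_rotation_fst z θ))).2
  refine (hf.abs_weightIntegrand_le hΔ hφm hd hp hL ht a _ _ x).trans ?_
  have h0 : 0 ≤ weightBound K Δ x := Finset.sum_nonneg fun μ _ =>
    mul_nonneg ((abs_nonneg _).trans (hf.abs_sensitivity_le (PA := PA) hΔ hφm t a z.1 x μ))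
      (Finset.sum_nonneg fun j _ => abs_nonneg _)
  have := norm_rotation_snd_le z θ
  gcongr

/-- The derivative grows at most linearly in the direction, and the norm has a second moment under a
Gaussian law. -/
theorem ReadoutBound.integrable_dMeanLogPartition_sq (hf : ReadoutBound f K) (hΔ : 0 < Δ)
    (hφ : Measurable φ) (hd : 0 < d) (hp : 0 < p) (hL : ∀ x, |deriv φ x| ≤ L)
    (ht : t ∈ Set.Icc (0 : ℝ) 1) (a : Fin p → ℝ) :
    Integrable (fun z => dMeanLogPartition n PA f Δ φ t a z ^ 2)
      ((weightLaw d p).prod (weightLaw d p)) := by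
  have h1 : MemLp (fun w => ‖w‖) 2 (weightLaw d p) :=
    (IsGaussian.memLp_id (weightLaw d p) 2 (by norm_num)).norm
  have h2 : MemLp (fun z : ((Fin p → Fin d → ℝ) × (Fin d → ℝ)) ×
      ((Fin p → Fin d → ℝ) × (Fin d → ℝ)) => ‖z.2‖) 2 ((weightLaw d p).prod (weightLaw d p)) :=
    h1.comp_snd _
  have h3 := (h2.const_mul ((∑ i, |a i|) * L + |rho φ|)).mul_const
    (∫ x : Fin n → Sample d k, weightBound K Δ x ∂(samplesLaw d n PA))
  exact (h3.mono' (hf.measurable_dMeanLogPartition Δ hφ t a).aestronglyMeasurable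
    (Filter.Eventually.of_forall fun z =>
      hf.abs_dMeanLogPartition_le hΔ hφ hd hp hL ht a z)).integrable_sq

end WeightVariance

/-! ### The gradient estimate of order `n² / d` -/

section GradientBound

variable {d p n k : ℕ} {PA : Measure (Fin k → ℝ)} [IsProbabilityMeasure PA]
  {f : ℝ → (Fin k → ℝ) → ℝ} {K Δ L t : ℝ} {φ : ℝ → ℝ}

/-- Pythagoras in each of the two blocks; the factor `2` comes from `(A + B)² ≤ 2 A² + 2 B²`, which
avoids the cross term. -/
theorem integral_weightLaw_sq_le (c : Fin p × Fin d → ℝ) (e : Fin d → ℝ) :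
    ∫ w, (∑ r, c r * w.1 r.1 r.2 + ∑ j, e j * w.2 j) ^ 2 ∂(weightLaw d p)
      ≤ 2 * (∑ r, c r ^ 2) + 2 * ∑ j, e j ^ 2 := by
  have hW : MemLp (fun W : Fin p → Fin d → ℝ => ∑ r : Fin p × Fin d, c r * W r.1 r.2) 2
      (gaussMat p d) := memLp_finsetSum _ fun r _ => (memLp_gaussMat_eval r.1 r.2).const_mul _
  have hv : MemLp (fun v : Fin d → ℝ => ∑ j, e j * v j) 2 (gaussVec d) :=
    memLp_finsetSum _ fun j _ => (memLp_gaussVec_eval j).const_mul _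
  have hW' : Integrable (fun w : (Fin p → Fin d → ℝ) × (Fin d → ℝ) =>
      (∑ r : Fin p × Fin d, c r * w.1 r.1 r.2) ^ 2) (weightLaw d p) :=
    hW.integrable_sq.comp_fst (gaussVec d)
  have hv' : Integrable (fun w : (Fin p → Fin d → ℝ) × (Fin d → ℝ) =>
      (∑ j, e j * w.2 j) ^ 2) (weightLaw d p) := hv.integrable_sq.comp_snd (gaussMat p d)
  have e1 : ∫ w, (∑ r : Fin p × Fin d, c r * w.1 r.1 r.2) ^ 2 ∂(weightLaw d p)
      = ∑ r, c r ^ 2 := by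
    rw [← integral_sq_sum_mul_eq (P := gaussMat p d)
      (X := fun (r : Fin p × Fin d) W => W r.1 r.2)
      (fun r => memLp_gaussMat_eval r.1 r.2) integral_gaussMat_eval_mul_eval c]
    simpa [weightLaw] using integral_fun_fst (μ := gaussMat p d) (ν := gaussVec d)
      (fun W => (∑ r : Fin p × Fin d, c r * W r.1 r.2) ^ 2)
  have e2 : ∫ w, (∑ j, e j * w.2 j) ^ 2 ∂(weightLaw d p) = ∑ j, e j ^ 2 := by
    rw [← integral_sq_sum_mul_eq (P := gaussVec d) (X := fun (j : Fin d) v => v j)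
      memLp_gaussVec_eval integral_gaussVec_eval_mul_eval e]
    simpa [weightLaw] using integral_fun_snd (μ := gaussMat p d) (ν := gaussVec d)
      (fun v => (∑ j, e j * v j) ^ 2)
  rw [← e1, ← e2, ← integral_const_mul, ← integral_const_mul,
    ← integral_add (hW'.const_mul 2) (hv'.const_mul 2)]
  refine integral_mono_of_nonneg (Filter.Eventually.of_forall fun w => sq_nonneg _)
    ((hW'.const_mul 2).add (hv'.const_mul 2)) (Filter.Eventually.of_forall fun w => ?_)
  simp only
  nlinarith [sq_nonneg ((∑ r : Fin p × Fin d, c r * w.1 r.1 r.2) - ∑ j, e j * w.2 j)]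

/-- Bessel's inequality in the input directions, summed over the samples. -/
theorem sum_sq_sum_integral_input_le {q : Fin n → (Fin n → Sample d k) → ℝ} {B M : ℝ}
    (hq : ∀ μ, MemLp (q μ) 2 (samplesLaw d n PA))
    (hM : ∀ μ, ∫ x, q μ x ^ 2 ∂(samplesLaw d n PA) ≤ B ^ 2 * M) :
    ∑ j, (∑ μ, ∫ x, q μ x * (x μ).2.1 j ∂(samplesLaw d n PA)) ^ 2 ≤ n ^ 2 * (B ^ 2 * M) := by
  -- Cauchy–Schwarz over the samples costs one factor `n`; the second counts the samples once Bessel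
  -- has absorbed the sum over `j`.
  calc _ ≤ ∑ j : Fin d, n * ∑ μ, (∫ x, q μ x * (x μ).2.1 j ∂(samplesLaw d n PA)) ^ 2 := by
        refine Finset.sum_le_sum fun j _ => ?_
        have := sq_sum_le_card_mul_sum_sq (s := Finset.univ)
          (f := fun μ : Fin n => ∫ x, q μ x * (x μ).2.1 j ∂(samplesLaw d n PA))
        simpa using this
    _ = n * ∑ μ, ∑ j, (∫ x, q μ x * (x μ).2.1 j ∂(samplesLaw d n PA)) ^ 2 := by
        rw [← Finset.mul_sum, Finset.sum_comm]
    _ ≤ n * ∑ _μ : Fin n, B ^ 2 * M := by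
        refine mul_le_mul_of_nonneg_left (Finset.sum_le_sum fun μ _ => ?_) (Nat.cast_nonneg _)
        exact (sum_sq_integral_mul_le (X := fun j (x : Fin n → Sample d k) => (x μ).2.1 j) (hq μ)
          (memLp_samples_input d n PA μ) (integral_samples_input_mul d n PA μ)).trans (hM μ)
    _ = _ := by simp; ring

theorem integral_sq_le_of_abs_le {q : (Fin n → Sample d k) → ℝ} {B : ℝ} {μ : Fin n}
    (h : ∀ x, |q x| ≤ B * sensNoiseBound K Δ (x μ).2.2.2) :
    ∫ x, q x ^ 2 ∂(samplesLaw d n PA)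
      ≤ B ^ 2 * ∫ z, sensNoiseBound K Δ z ^ 2 ∂(gaussianReal 0 1) := by
  rw [← integral_samples_sensNoiseBound_sq d n PA K Δ μ, ← integral_const_mul]
  refine integral_mono_of_nonneg (Filter.Eventually.of_forall fun w => sq_nonneg _)
    ((memLp_samples_sensNoiseBound d n PA K Δ μ).integrable_sq.const_mul _)
    (Filter.Eventually.of_forall fun x => ?_)
  simp only
  rw [← mul_pow, ← sq_abs (q x)]
  exact pow_le_pow_left₀ (abs_nonneg _) (h x) 2

theorem mul_dField_eq (s : ℝ) (a : Fin p → ℝ) (w w' : (Fin p → Fin d → ℝ) × (Fin d → ℝ))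
    (X : Fin d → ℝ) :
    s * dField φ t a w w' X =
      ∑ r : Fin p × Fin d, √(1 - t) * a r.1 / (√p * √d) * w'.1 r.1 r.2 *
          (s * deriv φ ((∑ j, w.1 r.1 j * X j) / √d) * X r.2)
        + ∑ j, √t * rho φ / √d * w'.2 j * (s * X j) := by
  unfold dField
  rw [Fintype.sum_prod_type, mul_add]
  congr 1
  · simp only [Finset.sum_div, Finset.mul_sum]
    refine Finset.sum_congr rfl fun i _ => Finset.sum_congr rfl fun j _ => ?_
    ring
  · simp only [Finset.sum_div, Finset.mul_sum]
    refine Finset.sum_congr rfl fun j _ => ?_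
    ring

/-- At fixed `w` the derivative is linear in the Gaussian direction `w'`, so its second moment is
controlled by the squares of its coefficients. These are correlations with the input coordinates,
and Bessel bounds the sum over `j` independently of `d`; the squared prefactor `1/√d` then remains
as the gain. -/
theorem ReadoutBound.integral_dMeanLogPartition_sq_le (hf : ReadoutBound f K) (hΔ : 0 < Δ)
    (hφ : Measurable φ) (hd : 0 < d) (hp : 0 < p) (hL : ∀ x, |deriv φ x| ≤ L)
    (ht : t ∈ Set.Icc (0 : ℝ) 1) (a : Fin p → ℝ) (w : (Fin p → Fin d → ℝ) × (Fin d → ℝ)) :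
    ∫ w', dMeanLogPartition n PA f Δ φ t a (w, w') ^ 2 ∂(weightLaw d p)
      ≤ 2 * (n ^ 2 / d * (L ^ 2 * ((∑ i, a i ^ 2) / p) + rho φ ^ 2) *
          ∫ z, sensNoiseBound K Δ z ^ 2 ∂(gaussianReal 0 1)) := by
  set M : ℝ := ∫ z, sensNoiseBound K Δ z ^ 2 ∂(gaussianReal 0 1)
  have hL0 : 0 ≤ L := (abs_nonneg _).trans (hL 0)
  have hM0 : 0 ≤ M := integral_nonneg fun z => sq_nonneg _
  have hd' : (0 : ℝ) < d := by exact_mod_cast hd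
  have hp' : (0 : ℝ) < p := by exact_mod_cast hp
  set s : Fin n → (Fin n → Sample d k) → ℝ := fun μ x => sensitivity PA f Δ φ t a w x μ
  set q : Fin p → Fin n → (Fin n → Sample d k) → ℝ :=
    fun i μ x => s μ x * deriv φ ((∑ j, w.1 i j * (x μ).2.1 j) / √d)
  have hsm : ∀ μ, Measurable (s μ) := fun μ => (hf.measurable_sensitivity Δ hφ t a μ).comp
    (f := fun x : Fin n → Sample d k => (w, x)) (by fun_prop)
  have hs : ∀ μ x, |s μ x| ≤ 1 * sensNoiseBound K Δ (x μ).2.2.2 := fun μ x => by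
    rw [one_mul]; exact hf.abs_sensitivity_le hΔ hφ t a w x μ
  have hq : ∀ i μ x, |q i μ x| ≤ L * sensNoiseBound K Δ (x μ).2.2.2 := fun i μ x => by
    have h1 := hs μ x
    rw [one_mul] at h1
    simp only [q]
    rw [abs_mul, mul_comm]
    exact mul_le_mul (hL _) h1 (abs_nonneg _) hL0
  have hqm : ∀ i μ, Measurable (q i μ) := fun i μ => (hsm μ).mul
    ((_root_.measurable_deriv φ).comp
      (f := fun x : Fin n → Sample d k => (∑ j, w.1 i j * (x μ).2.1 j) / √d) (by fun_prop))
  have hsL : ∀ μ, MemLp (s μ) 2 (samplesLaw d n PA) := fun μ =>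
    ((memLp_samples_sensNoiseBound d n PA K Δ μ).const_mul 1).mono' (hsm μ).aestronglyMeasurable
      (Filter.Eventually.of_forall (hs μ))
  have hqL : ∀ i μ, MemLp (q i μ) 2 (samplesLaw d n PA) := fun i μ =>
    ((memLp_samples_sensNoiseBound d n PA K Δ μ).const_mul L).mono'
      (hqm i μ).aestronglyMeasurable (Filter.Eventually.of_forall (hq i μ))
  -- `I` and `J` are the gradient coordinates in `W*` and `v*`, stripped of their scalar prefactors.
  set I : Fin p → Fin d → ℝ :=
    fun i j => ∑ μ, ∫ x, q i μ x * (x μ).2.1 j ∂(samplesLaw d n PA)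
  set J : Fin d → ℝ := fun j => ∑ μ, ∫ x, s μ x * (x μ).2.1 j ∂(samplesLaw d n PA)
  have hI : ∀ i, ∑ j, I i j ^ 2 ≤ n ^ 2 * (L ^ 2 * M) := fun i =>
    sum_sq_sum_integral_input_le (hqL i) fun μ => integral_sq_le_of_abs_le (hq i μ)
  have hJ : ∑ j, J j ^ 2 ≤ n ^ 2 * (1 ^ 2 * M) :=
    sum_sq_sum_integral_input_le hsL fun μ => integral_sq_le_of_abs_le (hs μ)
  have iq : ∀ i μ j, Integrable (fun x : Fin n → Sample d k => q i μ x * (x μ).2.1 j)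
      (samplesLaw d n PA) := fun i μ j => (hqL i μ).integrable_mul (memLp_samples_input d n PA μ j)
  have is : ∀ μ j, Integrable (fun x : Fin n → Sample d k => s μ x * (x μ).2.1 j)
      (samplesLaw d n PA) := fun μ j => (hsL μ).integrable_mul (memLp_samples_input d n PA μ j)
  have hrep : ∀ w', dMeanLogPartition n PA f Δ φ t a (w, w') =
      ∑ r : Fin p × Fin d, (√(1 - t) * a r.1 / (√p * √d) * I r.1 r.2) * w'.1 r.1 r.2
        + ∑ j, (√t * rho φ / √d * J j) * w'.2 j := by
    intro w'
    have i1 : ∀ μ, Integrable (fun x : Fin n → Sample d k => ∑ r : Fin p × Fin d,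
        √(1 - t) * a r.1 / (√p * √d) * w'.1 r.1 r.2 * (q r.1 μ x * (x μ).2.1 r.2))
        (samplesLaw d n PA) := fun μ =>
      integrable_finsetSum _ fun r _ => (iq r.1 μ r.2).const_mul _
    have i2 : ∀ μ, Integrable (fun x : Fin n → Sample d k =>
        ∑ j, √t * rho φ / √d * w'.2 j * (s μ x * (x μ).2.1 j)) (samplesLaw d n PA) := fun μ =>
      integrable_finsetSum _ fun j _ => (is μ j).const_mul _
    have e : dMeanLogPartition n PA f Δ φ t a (w, w') =
        ∫ x, ∑ μ, ((∑ r : Fin p × Fin d, √(1 - t) * a r.1 / (√p * √d) * w'.1 r.1 r.2 *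
          (q r.1 μ x * (x μ).2.1 r.2)) +
          ∑ j, √t * rho φ / √d * w'.2 j * (s μ x * (x μ).2.1 j)) ∂(samplesLaw d n PA) := by
      unfold dMeanLogPartition
      refine integral_congr_ae (Filter.Eventually.of_forall fun x =>
        Finset.sum_congr rfl fun μ _ => ?_)
      exact mul_dField_eq _ a w w' _
    rw [e, integral_finsetSum _ fun μ _ => (i1 μ).fun_add (i2 μ)]
    simp_rw [fun μ => integral_add (i1 μ) (i2 μ),
      fun μ => integral_finsetSum (μ := samplesLaw d n PA) Finset.univ
        fun (r : Fin p × Fin d) _ => (iq r.1 μ r.2).const_mul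
          (√(1 - t) * a r.1 / (√p * √d) * w'.1 r.1 r.2),
      fun μ => integral_finsetSum (μ := samplesLaw d n PA) Finset.univ
        fun (j : Fin d) _ => (is μ j).const_mul (√t * rho φ / √d * w'.2 j),
      integral_const_mul]
    rw [Finset.sum_add_distrib]
    congr 1
    · rw [Finset.sum_comm]
      refine Finset.sum_congr rfl fun r _ => ?_
      rw [← Finset.mul_sum]
      ring
    · rw [Finset.sum_comm]
      refine Finset.sum_congr rfl fun j _ => ?_
      rw [← Finset.mul_sum]
      ring
  simp_rw [hrep]
  refine (integral_weightLaw_sq_le _ _).trans ?_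
  have b1 : ∑ r : Fin p × Fin d, (√(1 - t) * a r.1 / (√p * √d) * I r.1 r.2) ^ 2
      ≤ n ^ 2 / d * (L ^ 2 * ((∑ i, a i ^ 2) / p)) * M := by
    rw [Fintype.sum_prod_type]
    calc _ = ∑ i, (1 - t) * (a i ^ 2 / (p * d)) * ∑ j, I i j ^ 2 := by
          refine Finset.sum_congr rfl fun i _ => ?_
          rw [Finset.mul_sum]
          refine Finset.sum_congr rfl fun j _ => ?_
          rw [mul_pow, div_pow, mul_pow, mul_pow, Real.sq_sqrt (by linarith [ht.2]),
            Real.sq_sqrt hp'.le, Real.sq_sqrt hd'.le]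
          ring
      _ ≤ ∑ i, 1 * (a i ^ 2 / (p * d)) * (n ^ 2 * (L ^ 2 * M)) := by
          refine Finset.sum_le_sum fun i _ => ?_
          have h1 := hI i
          have h2 : 1 - t ≤ 1 := by linarith [ht.1]
          have h3 : 0 ≤ 1 - t := by linarith [ht.2]
          gcongr
      _ = _ := by
          simp_rw [one_mul]
          rw [← Finset.sum_mul, ← Finset.sum_div]
          field_simp
  have b2 : ∑ j, (√t * rho φ / √d * J j) ^ 2 ≤ n ^ 2 / d * rho φ ^ 2 * M := by
    calc _ = t * (rho φ ^ 2 / d) * ∑ j, J j ^ 2 := by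
          rw [Finset.mul_sum]
          refine Finset.sum_congr rfl fun j _ => ?_
          rw [mul_pow, div_pow, mul_pow, Real.sq_sqrt ht.1, Real.sq_sqrt hd'.le]
          ring
      _ ≤ 1 * (rho φ ^ 2 / d) * (n ^ 2 * (1 ^ 2 * M)) := by
          have h1 := ht.1
          have h2 := ht.2
          gcongr
      _ = _ := by ring
  calc _ ≤ 2 * (n ^ 2 / d * (L ^ 2 * ((∑ i, a i ^ 2) / p)) * M)
        + 2 * (n ^ 2 / d * rho φ ^ 2 * M) := by gcongr
    _ = _ := by ring

/-- In the Poincaré inequality the direction is integrated first, at fixed position. The constant is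
`π²/8` times the `2` of the gradient bound. -/
theorem ReadoutBound.variance_meanLogPartition_le (hf : ReadoutBound f K) (hΔ : 0 < Δ)
    (hφ : Differentiable ℝ φ) (hd : 0 < d) (hp : 0 < p) (hL : ∀ x, |deriv φ x| ≤ L)
    (ht : t ∈ Set.Icc (0 : ℝ) 1) (a : Fin p → ℝ)
    (hG : MemLp (meanLogPartition n PA f Δ φ t a) 2 (weightLaw d p)) :
    Var[meanLogPartition n PA f Δ φ t a; weightLaw d p]
      ≤ Real.pi ^ 2 / 4 * (n ^ 2 / d * (L ^ 2 * ((∑ i, a i ^ 2) / p) + rho φ ^ 2) *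
          ∫ z, sensNoiseBound K Δ z ^ 2 ∂(gaussianReal 0 1)) := by
  have hφm := hφ.continuous.measurable
  have hint := hf.integrable_dMeanLogPartition_sq (PA := PA) (n := n) hΔ hφm hd hp hL ht a
  have h := variance_le_of_hasDerivAt_rotation (map_rotation_weightLaw d p) hG
    (hf.measurable_dMeanLogPartition Δ hφm t a) hint
    (hf.hasDerivAt_meanLogPartition hΔ hφ hd hp hL ht a) (fun z =>
      ⟨((∑ i, |a i|) * L + |rho φ|) * (‖z.1‖ + ‖z.2‖) *
        ∫ x : Fin n → Sample d k, weightBound K Δ x ∂(samplesLaw d n PA), fun θ => by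
        have hL0 : 0 ≤ L := (abs_nonneg _).trans (hL 0)
        have h0 : 0 ≤ ∫ x : Fin n → Sample d k, weightBound K Δ x ∂(samplesLaw d n PA) :=
          integral_nonneg fun x => Finset.sum_nonneg fun μ _ =>
            mul_nonneg ((abs_nonneg _).trans
              (hf.abs_sensitivity_le (PA := PA) hΔ hφm t a z.1 x μ))
              (Finset.sum_nonneg fun j _ => abs_nonneg _)
        refine (hf.abs_dMeanLogPartition_le hΔ hφm hd hp hL ht a _).trans ?_
        have := norm_rotation_snd_le z θ
        gcongr⟩)
  rw [integral_prod _ hint] at h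
  have h2 : ∫ w, ∫ w', dMeanLogPartition n PA f Δ φ t a (w, w') ^ 2 ∂(weightLaw d p)
      ∂(weightLaw d p) ≤ ∫ _, 2 * (n ^ 2 / d * (L ^ 2 * ((∑ i, a i ^ 2) / p) + rho φ ^ 2) *
          ∫ z, sensNoiseBound K Δ z ^ 2 ∂(gaussianReal 0 1)) ∂(weightLaw d p) :=
    integral_mono_of_nonneg
      (Filter.Eventually.of_forall fun w => integral_nonneg fun w' => sq_nonneg _)
      (integrable_const _) (Filter.Eventually.of_forall fun w =>
        hf.integral_dMeanLogPartition_sq_le hΔ hφm hd hp hL ht a w)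
  rw [integral_const] at h2
  simp only [probReal_univ, smul_eq_mul, one_mul] at h2
  refine h.trans ((mul_le_mul_of_nonneg_left h2 (by positivity)).trans (le_of_eq ?_))
  ring

end GradientBound

/-! ### Assembling the variance bound -/

section Concentration

variable {d p n k : ℕ} {PA : Measure (Fin k → ℝ)} [IsProbabilityMeasure PA]
  {f : ℝ → (Fin k → ℝ) → ℝ} {K Δ L t : ℝ} {φ : ℝ → ℝ}

theorem ReadoutBound.memLp_logPartition (hf : ReadoutBound f K) (hΔ : 0 < Δ)
    (hφ : Measurable φ) (t : ℝ) :
    MemLp (fun q : (Fin p → ℝ) × ((Fin p → Fin d → ℝ) × (Fin d → ℝ)) × (Fin n → Sample d k) =>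
      logPartition PA f Δ φ t q.1 q.2.1 q.2.2) 2
      ((gaussVec p).prod ((weightLaw d p).prod (samplesLaw d n PA))) := by
  have h1 : MemLp (fun x : Fin n → Sample d k => ∑ μ, logNoiseBound K Δ (x μ).2.2.2) 2
      (samplesLaw d n PA) := memLp_finsetSum _ fun μ _ =>
    (memLp_logNoiseBound K hΔ).comp_measurePreserving (measurePreserving_samples_noise d n PA μ)
  have h2 := (h1.comp_snd (weightLaw d p)).comp_snd (gaussVec p)
  exact h2.mono' (hf.measurable_logPartition Δ hφ t).aestronglyMeasurable
    (Filter.Eventually.of_forall fun q => hf.abs_logPartition_le hΔ hφ t q.1 q.2.1 q.2.2)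

theorem ReadoutBound.memLp_logPartition_weights (hf : ReadoutBound f K) (hΔ : 0 < Δ)
    (hφ : Measurable φ) (t : ℝ) (a : Fin p → ℝ) :
    MemLp (fun q : ((Fin p → Fin d → ℝ) × (Fin d → ℝ)) × (Fin n → Sample d k) =>
      logPartition PA f Δ φ t a q.1 q.2) 2 ((weightLaw d p).prod (samplesLaw d n PA)) := by
  have h1 : MemLp (fun x : Fin n → Sample d k => ∑ μ, logNoiseBound K Δ (x μ).2.2.2) 2
      (samplesLaw d n PA) := memLp_finsetSum _ fun μ _ =>
    (memLp_logNoiseBound K hΔ).comp_measurePreserving (measurePreserving_samples_noise d n PA μ)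
  refine (h1.comp_snd (weightLaw d p)).mono' ((hf.measurable_logPartition Δ hφ t).comp
    (f := fun q : ((Fin p → Fin d → ℝ) × (Fin d → ℝ)) × (Fin n → Sample d k) => (a, q.1, q.2))
    (by fun_prop)).aestronglyMeasurable
    (Filter.Eventually.of_forall fun q => hf.abs_logPartition_le hΔ hφ t a q.1 q.2)

theorem ReadoutBound.measurable_freeEntropy (hf : ReadoutBound f K) (Δ : ℝ)
    (hφ : Measurable φ) (t : ℝ) :
    Measurable fun q : (Fin p → ℝ) × Disorder d p n k => freeEntropy PA f Δ φ t q.1 q.2 := by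
  let g : (Fin p → ℝ) × Disorder d p n k →
      (Fin p → ℝ) × ((Fin p → Fin d → ℝ) × (Fin d → ℝ)) × (Fin n → Sample d k) :=
    fun q => (q.1, (q.2.1, q.2.2.1), fun μ => (q.2.2.2.1 μ, q.2.2.2.2.1 μ, q.2.2.2.2.2.1 μ,
      q.2.2.2.2.2.2 μ))
  have hg : Measurable g := by fun_prop
  exact ((hf.measurable_logPartition Δ hφ t).comp hg).const_mul _

theorem ReadoutBound.memLp_freeEntropy (hf : ReadoutBound f K) (hΔ : 0 < Δ)
    (hφ : Measurable φ) (t : ℝ) :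
    MemLp (fun q : (Fin p → ℝ) × Disorder d p n k => freeEntropy PA f Δ φ t q.1 q.2) 2
      ((gaussVec p).prod (disorderLaw d p n PA)) := by
  have hmp := (MeasurePreserving.id (gaussVec p)).prod (measurePreserving_toDisorder d p n PA)
  rw [← hmp.map_eq, memLp_map_measure_iff
    (hf.measurable_freeEntropy Δ hφ t).aestronglyMeasurable hmp.aemeasurable]
  exact (hf.memLp_logPartition hΔ hφ t).const_mul (1 / (n : ℝ))

/-- Total variance: the first summand is the fluctuation of the samples at fixed weights, the second
that of the sample average under the weights. -/
theorem ReadoutBound.variance_logPartition_le (hf : ReadoutBound f K) (hΔ : 0 < Δ)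
    (hφ : Differentiable ℝ φ) (hd : 0 < d) (hp : 0 < p) (hL : ∀ x, |deriv φ x| ≤ L)
    (ht : t ∈ Set.Icc (0 : ℝ) 1) (a : Fin p → ℝ) :
    Var[fun q : ((Fin p → Fin d → ℝ) × (Fin d → ℝ)) × (Fin n → Sample d k) =>
        logPartition PA f Δ φ t a q.1 q.2; (weightLaw d p).prod (samplesLaw d n PA)]
      ≤ 2 * n * (∫ z, logNoiseBound K Δ z ^ 2 ∂(gaussianReal 0 1)) +
        Real.pi ^ 2 / 4 * (n ^ 2 / d * (L ^ 2 * ((∑ i, a i ^ 2) / p) + rho φ ^ 2) *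
          ∫ z, sensNoiseBound K Δ z ^ 2 ∂(gaussianReal 0 1)) := by
  have hφm := hφ.continuous.measurable
  obtain ⟨hG, hvar⟩ := variance_prod_eq (hf.memLp_logPartition_weights (PA := PA) (d := d)
    (n := n) hΔ hφm t a)
  rw [hvar]
  refine add_le_add ?_ (hf.variance_meanLogPartition_le hΔ hφ hd hp hL ht a hG)
  calc _ ≤ ∫ _, 2 * n * ∫ z, logNoiseBound K Δ z ^ 2 ∂(gaussianReal 0 1) ∂(weightLaw d p) :=
        integral_mono_of_nonneg (Filter.Eventually.of_forall fun w => variance_nonneg _ _)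
          (integrable_const _) (Filter.Eventually.of_forall fun w =>
            (hf.memLp_and_variance_logPartition_le hΔ hφm t a w).2)
    _ = _ := by simp

theorem ReadoutBound.variance_freeEntropy_le (hf : ReadoutBound f K) (hΔ : 0 < Δ)
    (hφ : Differentiable ℝ φ) (hd : 0 < d) (hp : 0 < p) (hn : 0 < n) (hL : ∀ x, |deriv φ x| ≤ L)
    (ht : t ∈ Set.Icc (0 : ℝ) 1) (a : Fin p → ℝ) :
    Var[fun ω => freeEntropy PA f Δ φ t a ω; disorderLaw d p n PA]
      ≤ 2 * (∫ z, logNoiseBound K Δ z ^ 2 ∂(gaussianReal 0 1)) * (1 / n) +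
        Real.pi ^ 2 / 4 * (∫ z, sensNoiseBound K Δ z ^ 2 ∂(gaussianReal 0 1)) *
          (L ^ 2 * ((∑ i, a i ^ 2) / p) + rho φ ^ 2) * (1 / d) := by
  have hn' : (0 : ℝ) < n := by exact_mod_cast hn
  have hmeas : Measurable fun ω : Disorder d p n k => freeEntropy PA f Δ φ t a ω :=
    (hf.measurable_freeEntropy Δ hφ.continuous.measurable t).comp
      (f := fun ω : Disorder d p n k => (a, ω)) (by fun_prop)
  have hvar := (measurePreserving_toDisorder d p n PA).variance_fun_comp hmeas.aemeasurable
  have hscale : (fun q => freeEntropy PA f Δ φ t a (toDisorder q)) =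
      fun q : ((Fin p → Fin d → ℝ) × (Fin d → ℝ)) × (Fin n → Sample d k) =>
        1 / (n : ℝ) * logPartition PA f Δ φ t a q.1 q.2 :=
    funext fun q => freeEntropy_toDisorder t a q
  rw [← hvar, hscale, variance_const_mul]
  refine (mul_le_mul_of_nonneg_left (hf.variance_logPartition_le hΔ hφ hd hp hL ht a)
    (by positivity)).trans (le_of_eq ?_)
  generalize (∫ z, logNoiseBound K Δ z ^ 2 ∂(gaussianReal 0 1)) = M₁
  generalize (∫ z, sensNoiseBound K Δ z ^ 2 ∂(gaussianReal 0 1)) = M₂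
  field_simp

theorem integral_sum_sq_gaussVec (p : ℕ) :
    Integrable (fun a : Fin p → ℝ => ∑ i, a i ^ 2) (gaussVec p) ∧
      ∫ a, ∑ i, a i ^ 2 ∂(gaussVec p) = p := by
  have h : ∀ i : Fin p, Integrable (fun a : Fin p → ℝ => a i ^ 2) (gaussVec p) :=
    fun i => (memLp_gaussVec_eval i).integrable_sq
  refine ⟨integrable_finsetSum _ fun i _ => h i, ?_⟩
  rw [integral_finsetSum _ fun i _ => h i]
  have e : ∀ i : Fin p, ∫ a : Fin p → ℝ, a i ^ 2 ∂(gaussVec p) = 1 := fun i => by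
    have := integral_gaussVec_eval_mul_eval i i
    simpa [sq] using this
  simp [e]

/-- The bound at fixed `a` is affine in `|a|² / p`, whose mean is `1`; hence no dependence on `p` is
left. -/
theorem ReadoutBound.integral_variance_freeEntropy_le (hf : ReadoutBound f K) (hΔ : 0 < Δ)
    (hφ : Differentiable ℝ φ) (hd : 0 < d) (hp : 0 < p) (hn : 0 < n) (hL : ∀ x, |deriv φ x| ≤ L)
    (ht : t ∈ Set.Icc (0 : ℝ) 1) :
    ∫ a, Var[fun ω => freeEntropy PA f Δ φ t a ω; disorderLaw d p n PA] ∂(gaussVec p)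
      ≤ 2 * (∫ z, logNoiseBound K Δ z ^ 2 ∂(gaussianReal 0 1)) * (1 / n) +
        Real.pi ^ 2 / 4 * (∫ z, sensNoiseBound K Δ z ^ 2 ∂(gaussianReal 0 1)) *
          (L ^ 2 + rho φ ^ 2) * (1 / d) := by
  obtain ⟨hi, he⟩ := integral_sum_sq_gaussVec p
  have hp' : (0 : ℝ) < p := by exact_mod_cast hp
  set M₁ := 2 * (∫ z, logNoiseBound K Δ z ^ 2 ∂(gaussianReal 0 1)) * (1 / (n : ℝ))
  set M₂ := Real.pi ^ 2 / 4 * ∫ z, sensNoiseBound K Δ z ^ 2 ∂(gaussianReal 0 1)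
  have e : ∀ a : Fin p → ℝ, M₁ + M₂ * (L ^ 2 * ((∑ i, a i ^ 2) / p) + rho φ ^ 2) * (1 / (d : ℝ))
      = (M₁ + M₂ * rho φ ^ 2 * (1 / (d : ℝ)))
        + M₂ * L ^ 2 * (1 / (d : ℝ)) / p * ∑ i, a i ^ 2 := fun a => by ring
  calc _ ≤ ∫ a : Fin p → ℝ, ((M₁ + M₂ * rho φ ^ 2 * (1 / (d : ℝ)))
        + M₂ * L ^ 2 * (1 / (d : ℝ)) / p * ∑ i, a i ^ 2) ∂(gaussVec p) :=
        integral_mono_of_nonneg (Filter.Eventually.of_forall fun a => variance_nonneg _ _)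
          ((integrable_const _).add (hi.const_mul _)) (Filter.Eventually.of_forall fun a =>
            (hf.variance_freeEntropy_le hΔ hφ hd hp hn hL ht a).trans (le_of_eq (e a)))
    _ = _ := by
        rw [integral_add (integrable_const _) (hi.const_mul _), integral_const_mul, he,
          integral_const]
        simp only [probReal_univ, smul_eq_mul, one_mul]
        field_simp
        ring

/-- Fubini; the sections of `g` are known to be measurable only for almost every `a`, which suffices
under the integral. -/
theorem integral_variance_eq {α β : Type*} [MeasurableSpace α] [MeasurableSpace β]
    {P : Measure α} {Q : Measure β} [IsProbabilityMeasure P] [IsProbabilityMeasure Q]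
    {g : α → β → ℝ} (hg : MemLp (fun q : α × β => g q.1 q.2) 2 (P.prod Q)) :
    ∫ a, Var[fun ω => g a ω; Q] ∂P = ∫ q, (g q.1 q.2 - ∫ ω, g q.1 ω ∂Q) ^ 2 ∂(P.prod Q) := by
  have hG := (variance_prod_eq hg).1.comp_fst Q
  have hsq : Integrable (fun q : α × β => (g q.1 q.2 - ∫ ω, g q.1 ω ∂Q) ^ 2) (P.prod Q) :=
    (hg.sub hG).integrable_sq
  rw [integral_prod _ hsq]
  refine integral_congr_ae ?_
  filter_upwards [(hg.integrable (by norm_num)).prod_right_ae] with a ha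
  exact variance_eq_integral ha.aestronglyMeasurable.aemeasurable

end Concentration

/-! ### Reduction to a readout regular for every `A` -/

section Reduction

variable {k : ℕ} {PA : Measure (Fin k → ℝ)} {f : ℝ → (Fin k → ℝ) → ℝ}

/-- A readout that is regular for almost every `A` agrees, outside a null set of `A`, with one that
is regular for every `A`. -/
theorem ReadoutRegular.exists_readoutBound (hf : ReadoutRegular PA f) :
    ∃ (g : ℝ → (Fin k → ℝ) → ℝ) (K : ℝ), ReadoutBound g K ∧ ∀ᵐ A ∂PA, ∀ x, f x A = g x A := by
  obtain ⟨K, hK⟩ := hf.bdd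
  have hae : ∀ᵐ A ∂PA, (Differentiable ℝ fun x => f x A) ∧
      ∀ x, |f x A| ≤ K ∧ |deriv (fun x => f x A) x| ≤ K := by
    filter_upwards [hf.differentiable, hK] with A h1 h2
    exact ⟨h1.1, fun x => ⟨(h2 x).1, (h2 x).2.1⟩⟩
  -- A measurable conull set keeps the modified readout jointly measurable. The bound is `|K|`
  -- because the zero function used off `T` needs a nonnegative constant.
  obtain ⟨T, hTae, hTm, hT⟩ := hae.exists_measurable_mem
  classical
  refine ⟨fun x A => if A ∈ T then f x A else 0, |K|, ⟨?_, ?_, ?_, ?_⟩, ?_⟩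
  · exact Measurable.ite (measurable_snd hTm) hf.measurable measurable_const
  · intro A
    by_cases hA : A ∈ T
    · simpa [hA] using (hT A hA).1
    · simp [hA]
  · intro x A
    by_cases hA : A ∈ T
    · simpa [hA] using ((hT A hA).2 x).1.trans (le_abs_self K)
    · simp [hA]
  · intro x A
    by_cases hA : A ∈ T
    · simpa [hA] using ((hT A hA).2 x).2.trans (le_abs_self K)
    · simp [hA]
  · filter_upwards [hTae] with A hA x
    simp [show A ∈ T from hA]

theorem Pout_congr {g : ℝ → (Fin k → ℝ) → ℝ} (h : ∀ᵐ A ∂PA, ∀ x, f x A = g x A) (Δ : ℝ) :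
    Pout PA f Δ = Pout PA g Δ := by
  funext y x
  refine integral_congr_ae ?_
  filter_upwards [h] with A hA
  rw [hA x]

/-- `P_out` is unchanged everywhere, being an average over `A`. The responses change only on a null
event for the `A_μ`, so one null set serves all `a`. -/
theorem freeEntropy_congr [IsProbabilityMeasure PA] {g : ℝ → (Fin k → ℝ) → ℝ}
    (h : ∀ᵐ A ∂PA, ∀ x, f x A = g x A) (Δ : ℝ) (φ : ℝ → ℝ) (t : ℝ) (d p n : ℕ) :
    ∀ᵐ ω ∂(disorderLaw d p n PA), ∀ a, freeEntropy PA f Δ φ t a ω = freeEntropy PA g Δ φ t a ω := by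
  have hA : ∀ᵐ A ∂(Measure.pi fun _ : Fin n => PA), ∀ μ x, f x (A μ) = g x (A μ) :=
    ae_all_iff.2 fun μ => (measurePreserving_eval (fun _ : Fin n => PA) μ).quasiMeasurePreserving.ae h
  have hproj : MeasurePreserving (fun ω : Disorder d p n k => ω.2.2.2.2.1) (disorderLaw d p n PA)
      (Measure.pi fun _ : Fin n => PA) :=
    measurePreserving_fst.comp (measurePreserving_snd.comp (measurePreserving_snd.comp
      (measurePreserving_snd.comp measurePreserving_snd)))
  filter_upwards [hproj.quasiMeasurePreserving.ae hA] with ω hω a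
  have hr : response f Δ φ t a ω = response g Δ φ t a ω := by
    obtain ⟨W, v, ξ, X, A, Z⟩ := ω
    funext μ
    simp only [response]
    rw [hω μ]
  unfold freeEntropy partitionFn logPout
  rw [hr, Pout_congr h]

end Reduction

end TwoLayer

end

/-! ### The concentration theorem -/

theorem mainTheorem2 {k : ℕ} (PA : Measure (Fin k → ℝ)) [IsProbabilityMeasure PA]
    (f : ℝ → (Fin k → ℝ) → ℝ) (hf : TwoLayer.ReadoutRegular PA f)
    (φ : ℝ → ℝ) (hφ : TwoLayer.ActivationRegular φ) (Δ : ℝ) (hΔ : 0 < Δ) :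
    ∃ C : ℝ, 0 ≤ C ∧ ∀ d p n : ℕ, 0 < d → 0 < p → 0 < n → ∀ t ∈ Set.Icc (0 : ℝ) 1,
      MemLp (fun q : (Fin p → ℝ) × TwoLayer.Disorder d p n k =>
          TwoLayer.freeEntropy PA f Δ φ t q.1 q.2) 2
        ((TwoLayer.gaussVec p).prod (TwoLayer.disorderLaw d p n PA)) ∧
      (∫ a, variance (fun ω : TwoLayer.Disorder d p n k => TwoLayer.freeEntropy PA f Δ φ t a ω)
          (TwoLayer.disorderLaw d p n PA) ∂(TwoLayer.gaussVec p)) =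
        (∫ q : (Fin p → ℝ) × TwoLayer.Disorder d p n k,
          (TwoLayer.freeEntropy PA f Δ φ t q.1 q.2 -
            ∫ ω, TwoLayer.freeEntropy PA f Δ φ t q.1 ω ∂(TwoLayer.disorderLaw d p n PA)) ^ 2
          ∂((TwoLayer.gaussVec p).prod (TwoLayer.disorderLaw d p n PA))) ∧
      (∫ a, variance (fun ω : TwoLayer.Disorder d p n k => TwoLayer.freeEntropy PA f Δ φ t a ω)
          (TwoLayer.disorderLaw d p n PA) ∂(TwoLayer.gaussVec p)) ≤
        C * (1 / (d : ℝ) + 1 / (n : ℝ)) := by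
  obtain ⟨g, K, hg, hfg⟩ := hf.exists_readoutBound
  obtain ⟨L, hL⟩ := hφ.lipschitz
  have hφd : Differentiable ℝ φ := hφ.contDiff.differentiable (by norm_num)
  have hφm := hφd.continuous.measurable
  have hL' : ∀ x, |deriv φ x| ≤ (L : ℝ) := fun x => norm_deriv_le_of_lipschitz hL
  set M₁ := 2 * ∫ z, TwoLayer.logNoiseBound K Δ z ^ 2 ∂(gaussianReal 0 1)
  set M₂ := Real.pi ^ 2 / 4 * (∫ z, TwoLayer.sensNoiseBound K Δ z ^ 2 ∂(gaussianReal 0 1)) *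
    ((L : ℝ) ^ 2 + TwoLayer.rho φ ^ 2)
  have hM₁ : 0 ≤ M₁ := mul_nonneg zero_le_two (integral_nonneg fun z => sq_nonneg _)
  have hM₂ : 0 ≤ M₂ := mul_nonneg (mul_nonneg (by positivity)
    (integral_nonneg fun z => sq_nonneg _)) (by positivity)
  -- The bound obtained is `M₁ / n + M₂ / d`; both constants are fixed before `d`, `p`, `n` and `t`.
  refine ⟨M₁ + M₂, add_nonneg hM₁ hM₂, fun d p n hd hp hn t ht => ?_⟩
  have hcongr := TwoLayer.freeEntropy_congr hfg Δ φ t d p n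
  have hmem : MemLp (fun q : (Fin p → ℝ) × TwoLayer.Disorder d p n k =>
      TwoLayer.freeEntropy PA f Δ φ t q.1 q.2) 2
      ((TwoLayer.gaussVec p).prod (TwoLayer.disorderLaw d p n PA)) := by
    refine (hg.memLp_freeEntropy hΔ hφm t).ae_eq ?_
    filter_upwards [Measure.quasiMeasurePreserving_snd.ae hcongr] with q hq
    exact (hq q.1).symm
  refine ⟨hmem, TwoLayer.integral_variance_eq hmem, ?_⟩
  have hvar : ∀ a, variance (fun ω : TwoLayer.Disorder d p n k =>
      TwoLayer.freeEntropy PA f Δ φ t a ω) (TwoLayer.disorderLaw d p n PA)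
      = variance (fun ω : TwoLayer.Disorder d p n k =>
      TwoLayer.freeEntropy PA g Δ φ t a ω) (TwoLayer.disorderLaw d p n PA) := fun a =>
    variance_congr (hcongr.mono fun ω hω => hω a)
  simp_rw [hvar]
  refine (hg.integral_variance_freeEntropy_le hΔ hφd hd hp hn hL' ht).trans ?_
  have h1 : (0 : ℝ) ≤ 1 / n := by positivity
  have h2 : (0 : ℝ) ≤ 1 / d := by positivity
  change M₁ * (1 / (n : ℝ)) + M₂ * (1 / (d : ℝ)) ≤ _
  nlinarith [mul_nonneg hM₁ h2, mul_nonneg hM₂ h1]
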